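/- Let $\Bbbk$ be a field, let $x_1,\dots,x_n$ be indeterminates of degrees $|x_i|\in\mathbb Z$, and let $$R=\Bbbk\langle x_1,\dots,x_n\rangle/\langle x_ix_j-(-1)^{|x_i||x_j|}x_jx_i\mid 1\le i,j\le n\rangle$$ be the graded commutative polynomial algebra, equipped with an arbitrary structure of a differential graded Poisson algebra: a differential $d$ of degree $1$ with $d^2=0$ and a bracket $\{\cdot,\cdot\}$ of degree $0$ which is graded antisymmetric, satisfies the graded Jacobi identity, is a graded derivation of the product in the second argument, and satisfies $d\{a,b\}=\{da,b\}+(-1)^{|a|}\{a,db\}$. If $\operatorname{char}\Bbbk=2$, assume that $\{x_i,x_i\}=0$ for all $i$; if $\operatorname{char}\Bbbk=3$, assume that $\{x_i,\{x_i,x_i\}\}=0$ for all $i$ with $|x_i|$ odd (in characteristic other than $2,3$ nothing is assumed). For $1\le r\le n$ let $\psi_r:R\to R$ be the $\Bbbk$-linear map with $\psi_r(x_s)=\delta_{rs}$ and $\psi_r(ab)=a\psi_r(b)+(-1)^{|a||b|}b\psi_r(a)$ for homogeneous $a,b$. Let $F(R)=R\langle y_1,\dots,y_n\rangle$ be obtained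 from $R$ by freely adjoining noncommuting indeterminates $y_i$ (which do not commute with $R$ either) with $|y_i|=|x_i|$, put $\psi(f)=\sum_r\psi_r(f)y_r$, and let $R^e=F(R)/\mathfrak J$ be the universal enveloping algebra of $R$, where $\mathfrak J$ is the two-sided ideal generated by $$y_iy_j-(-1)^{|x_i||x_j|}y_jy_i-\psi(\{x_i,x_j\}),\qquad y_ix_j-(-1)^{|x_i||x_j|}x_jy_i-\{x_i,x_j\}\qquad(1\le i,j\le n).$$ Let $E$ be the set of all $J=(j_1,\dots,j_n)\in\mathbb N^n$ such that $j_r\le 1$ whenever $|x_r|$ is odd and $\operatorname{char}\Bbbk\ne 2$ (so $E=\mathbb N^n$ if all $|x_r|$ are even). Write $x^I=x_1^{i_1}\cdots x_n^{i_n}$ and $y^J=y_1^{j_1}\cdots y_n^{j_n}$. Then $R^e$ has a differential making it a DG algebra such that the canonical maps $R\to R^e$, $f\mapsto f$ and $f\mapsto\psi(f)$, commute with the differentials; thus $R^e$ is a left and a right DG $R$-module. As a graded left $R$-module and as a graded right $R$-module, $R^e$ is free with the homogeneous basis $\{y^J\mid J\in E\}$. Moreover, both $\{x^Iy^J\mid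 I,J\in E\}$ and the reversed monomials $\{y^Jx^I\mid I,J\in E\}$ are $\Bbbk$-bases of $R^e$. -/

import Mathlib

noncomputable section

namespace DGPoisson

open MulOpposite

/-! ### Differential graded algebras, DG Poisson algebras, DG modules -/

section General

variable {k : Type*} [Field k] {A : Type*} [Ring A] [Algebra k A]

/-- `d` is a differential making the `ℤ`-graded algebra `A` into a DG algebra. -/
structure IsDGAlgebra (𝒜 : ℤ → Submodule k A) [GradedAlgebra 𝒜] (d : A →ₗ[k] A) : Prop where
  map_mem : ∀ (p : ℤ), ∀ a ∈ 𝒜 p, d a ∈ 𝒜 (p + 1)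
  sq_zero : ∀ a, d (d a) = 0
  leibniz : ∀ (p : ℤ), ∀ a ∈ 𝒜 p, ∀ b, d (a * b) = d a * b + (-1 : k) ^ p • (a * d b)

/-- A DG Poisson algebra structure (differential and Poisson bracket of degree `0`) on the
`ℤ`-graded algebra `A`. -/
structure DGPoissonStructure (𝒜 : ℤ → Submodule k A) [GradedAlgebra 𝒜] where
  bracket : A →ₗ[k] A →ₗ[k] A
  d : A →ₗ[k] A
  isDGAlgebra : IsDGAlgebra 𝒜 d
  mul_comm : ∀ (p q : ℤ), ∀ a ∈ 𝒜 p, ∀ b ∈ 𝒜 q, a * b = (-1 : k) ^ (p * q) • (b * a)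
  bracket_mem : ∀ (p q : ℤ), ∀ a ∈ 𝒜 p, ∀ b ∈ 𝒜 q, bracket a b ∈ 𝒜 (p + q)
  antisymm : ∀ (p q : ℤ), ∀ a ∈ 𝒜 p, ∀ b ∈ 𝒜 q,
    bracket a b = -((-1 : k) ^ (p * q) • bracket b a)
  jacobi : ∀ (p q r : ℤ), ∀ a ∈ 𝒜 p, ∀ b ∈ 𝒜 q, ∀ c ∈ 𝒜 r,
    bracket a (bracket b c) =
      bracket (bracket a b) c + (-1 : k) ^ (p * q) • bracket b (bracket a c)
  bracket_mul : ∀ (p q r : ℤ), ∀ a ∈ 𝒜 p, ∀ b ∈ 𝒜 q, ∀ c ∈ 𝒜 r,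
    bracket a (b * c) = bracket a b * c + (-1 : k) ^ (p * q) • (b * bracket a c)
  d_bracket : ∀ (p q : ℤ), ∀ a ∈ 𝒜 p, ∀ b ∈ 𝒜 q,
    d (bracket a b) = bracket (d a) b + (-1 : k) ^ p • bracket a (d b)

variable {M : Type*} [AddCommGroup M] [Module k M]

/-- The graded left module `M` over the DG algebra `(A, d)` is, with `δ`, a left DG module. -/
structure IsLeftDGModule [Module A M] (𝒜 : ℤ → Submodule k A) (d : A →ₗ[k] A)
    (ℳ : ℤ → Submodule k M) (δ : M →ₗ[k] M) : Prop where
  isInternal : DirectSum.IsInternal ℳ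
  smul_mem : ∀ (p q : ℤ), ∀ a ∈ 𝒜 p, ∀ m ∈ ℳ q, a • m ∈ ℳ (p + q)
  map_mem : ∀ (p : ℤ), ∀ m ∈ ℳ p, δ m ∈ ℳ (p + 1)
  sq_zero : ∀ m, δ (δ m) = 0
  leibniz : ∀ (p : ℤ), ∀ a ∈ 𝒜 p, ∀ m, δ (a • m) = d a • m + (-1 : k) ^ p • (a • δ m)

/-- The graded right module `M` over the DG algebra `(A, d)` is, with `δ`, a right DG module
(`op a • m` is `m a`). -/
structure IsRightDGModule [Module Aᵐᵒᵖ M] (𝒜 : ℤ → Submodule k A) (d : A →ₗ[k] A)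
    (ℳ : ℤ → Submodule k M) (δ : M →ₗ[k] M) : Prop where
  isInternal : DirectSum.IsInternal ℳ
  smul_mem : ∀ (p q : ℤ), ∀ m ∈ ℳ p, ∀ a ∈ 𝒜 q, op a • m ∈ ℳ (p + q)
  map_mem : ∀ (p : ℤ), ∀ m ∈ ℳ p, δ m ∈ ℳ (p + 1)
  sq_zero : ∀ m, δ (δ m) = 0
  leibniz : ∀ (p : ℤ), ∀ m ∈ ℳ p, ∀ a,
    δ (op a • m) = op a • δ m + (-1 : k) ^ p • (op (d a) • m)

/-- The family `v` is a basis of the module `M` over the (not necessarily commutative) ring `S`. -/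
def IsBasis (S : Type*) [Ring S] {M : Type*} [AddCommGroup M] [Module S M] {ι : Type*}
    (v : ι → M) : Prop :=
  LinearIndependent S v ∧ Submodule.span S (Set.range v) = ⊤

/-- For elements `g i` of an algebra with weights `w i`, the span of all words of weight `m`. -/
def wordGrading (k : Type*) [Field k] {A : Type*} [Ring A] [Algebra k A] {ι : Type*}
    (g : ι → A) (w : ι → ℤ) (m : ℤ) : Submodule k A :=
  Submodule.span k {a | ∃ l : List ι, (l.map w).sum = m ∧ (l.map g).prod = a}

/-- The ordered monomial `g₁ ^ J₁ ⋯ gₙ ^ Jₙ`. -/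
def orderedMonomial {n : ℕ} (g : Fin n → A) (J : Fin n → ℕ) : A :=
  (List.ofFn fun r => g r ^ J r).prod

variable {ι : Type*} (g : ι → A) (w : ι → ℤ)

theorem gen_mem (i : ι) : g i ∈ wordGrading k g w (w i) :=
  Submodule.subset_span ⟨[i], by simp, by simp⟩

instance wordGrading_gradedMonoid : SetLike.GradedMonoid (wordGrading k g w) where
  one_mem := Submodule.subset_span ⟨[], by simp, by simp⟩
  mul_mem := by
    intro p q a b ha hb
    have h : a * b ∈ wordGrading k g w p * wordGrading k g w q := Submodule.mul_mem_mul ha hb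
    rw [wordGrading, wordGrading, Submodule.span_mul_span] at h
    refine Submodule.span_mono ?_ h
    rintro _ ⟨_, ⟨l, hl, rfl⟩, _, ⟨l', hl', rfl⟩, rfl⟩
    exact ⟨l ++ l', by simp [hl, hl'], by simp⟩

theorem hom_word_eq (θ : A →ₐ[k] DirectSum ℤ fun m => wordGrading k g w m)
    (hθ : ∀ i, θ (g i) = DirectSum.of (fun m => wordGrading k g w m) (w i) ⟨g i, gen_mem g w i⟩)
    (m : ℤ) (a : wordGrading k g w m) :
    θ a = DirectSum.of (fun m => wordGrading k g w m) m a := by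
  obtain ⟨a, ha⟩ := a
  have key : ∀ l : List ι, ∀ (h : (l.map g).prod ∈ wordGrading k g w (l.map w).sum),
      θ (l.map g).prod = DirectSum.of (fun m => wordGrading k g w m) (l.map w).sum ⟨_, h⟩ := by
    intro l
    induction l with
    | nil => intro h; simp; rfl
    | cons i l ih =>
      intro h
      have h' : (l.map g).prod ∈ wordGrading k g w (l.map w).sum :=
        Submodule.subset_span ⟨l, rfl, rfl⟩
      have e : θ (((i :: l).map g).prod) = θ (g i) * θ (l.map g).prod := by simp
      rw [e, hθ, ih h', DirectSum.of_mul_of]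
      exact DirectSum.of_eq_of_gradedMonoid_eq (Sigma.subtype_ext rfl rfl)
  induction ha using Submodule.span_induction with
  | mem x hx => obtain ⟨l, rfl, rfl⟩ := hx; exact key l _
  | zero => simp only [map_zero]; exact (map_zero _).symm
  | add x y hx hy ihx ihy => simp only [map_add, ihx, ihy]; exact (map_add _ _ _).symm
  | smul c x hx ih =>
    simp only [map_smul, ih]
    exact (map_smul (DirectSum.lof k ℤ (fun m => wordGrading k g w m) m) c ⟨x, hx⟩).symm

end General

/-! ### The graded commutative polynomial algebra -/

section Poly

variable (k : Type*) [Field k] {n : ℕ} (deg : Fin n → ℤ)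

/-- The relations `x_i x_j = (-1)^{|x_i||x_j|} x_j x_i` in the tensor (free) algebra. -/
inductive PolyRel : FreeAlgebra k (Fin n) → FreeAlgebra k (Fin n) → Prop
  | comm (i j : Fin n) : PolyRel (FreeAlgebra.ι k i * FreeAlgebra.ι k j)
      ((-1 : k) ^ (deg i * deg j) • (FreeAlgebra.ι k j * FreeAlgebra.ι k i))

/-- `R = T(V) / ⟨x_i ⊗ x_j - (-1)^{|x_i||x_j|} x_j ⊗ x_i⟩`, where `V` has the homogeneous basis
`x_1, …, x_n` with `|x_i| = deg i`. -/
def Poly : Type _ := RingQuot (PolyRel k deg)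

instance : Ring (Poly k deg) := inferInstanceAs (Ring (RingQuot (PolyRel k deg)))
instance : Algebra k (Poly k deg) := inferInstanceAs (Algebra k (RingQuot (PolyRel k deg)))

namespace Poly

/-- The projection `T(V) → R`. -/
def mk : FreeAlgebra k (Fin n) →ₐ[k] Poly k deg := RingQuot.mkAlgHom k (PolyRel k deg)

/-- The generator `x_i` of `R`. -/
def x (i : Fin n) : Poly k deg := mk k deg (FreeAlgebra.ι k i)

/-- `R_m`, the homogeneous elements of degree `m`. -/
abbrev grading : ℤ → Submodule k (Poly k deg) := wordGrading k (x k deg) deg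

variable {k deg}

theorem x_comm (i j : Fin n) :
    x k deg i * x k deg j = (-1 : k) ^ (deg i * deg j) • (x k deg j * x k deg i) := by
  have h : mk k deg _ = mk k deg _ :=
    RingQuot.mkAlgHom_rel k (PolyRel.comm (k := k) (deg := deg) i j)
  rwa [map_smul, map_mul, map_mul] at h

/-- The universal property of `R`. -/
def lift {B : Type*} [Ring B] [Algebra k B] (g : Fin n → B)
    (hg : ∀ i j, g i * g j = (-1 : k) ^ (deg i * deg j) • (g j * g i)) : Poly k deg →ₐ[k] B :=
  RingQuot.liftAlgHom k ⟨FreeAlgebra.lift k g, by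
    rintro _ _ ⟨i, j⟩
    simpa using hg i j⟩

@[simp] theorem lift_x {B : Type*} [Ring B] [Algebra k B] (g : Fin n → B)
    (hg : ∀ i j, g i * g j = (-1 : k) ^ (deg i * deg j) • (g j * g i)) (i : Fin n) :
    lift g hg (x k deg i) = g i :=
  (RingQuot.liftAlgHom_mkAlgHom_apply k _ _ _).trans (FreeAlgebra.lift_ι_apply _ _)

theorem hom_ext {B : Type*} [Ring B] [Algebra k B] {φ φ' : Poly k deg →ₐ[k] B}
    (h : ∀ i, φ (x k deg i) = φ' (x k deg i)) : φ = φ' := by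
  apply RingQuot.ringQuot_ext'
  apply FreeAlgebra.hom_ext
  funext i
  exact h i

/-- The decomposition of `R` into homogeneous components. -/
def decomposeHom : Poly k deg →ₐ[k] DirectSum ℤ fun m => grading k deg m :=
  lift (fun i => DirectSum.of (fun m => grading k deg m) (deg i) ⟨x k deg i, gen_mem _ _ i⟩)
    (by
      intro i j
      rw [DirectSum.of_mul_of, DirectSum.of_mul_of]
      change _ = (-1 : k) ^ (deg i * deg j) • DirectSum.lof k ℤ (fun m => grading k deg m) _ _
      rw [← map_smul]
      refine DirectSum.of_eq_of_gradedMonoid_eq (Sigma.subtype_ext (add_comm _ _) ?_)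
      exact x_comm i j)

instance : GradedAlgebra (grading k deg) :=
  GradedAlgebra.ofAlgHom (grading k deg) decomposeHom
    (hom_ext fun i => by simp [decomposeHom])
    (fun m a => hom_word_eq (x k deg) deg decomposeHom (fun i => lift_x _ _ i) m a)

theorem sign_mul_self (a : ℤ) : (-1 : k) ^ a * (-1 : k) ^ a = 1 := by
  rw [← mul_zpow]; simp

/-- The algebra map `a ↦ !![a, ψ_r(a); 0, (-1)^{|x_r||a|} a]` to `2 × 2` matrices. -/
def psiMatrix (r : Fin n) : Poly k deg →ₐ[k] Matrix (Fin 2) (Fin 2) (Poly k deg) :=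
  lift (fun s => !![x k deg s, if s = r then 1 else 0;
      0, (-1 : k) ^ (deg r * deg s) • x k deg s]) (by
    intro i j
    have e := x_comm (k := k) (deg := deg) i j
    have s1 := sign_mul_self (k := k) (deg i * deg j)
    simp only [Matrix.mul_fin_two, Matrix.smul_of, Matrix.smul_cons, Matrix.smul_empty]
    congr 1
    have h01 : x k deg i * (if j = r then 1 else 0) +
        (if i = r then 1 else 0) * ((-1 : k) ^ (deg r * deg j) • x k deg j) =
        (-1 : k) ^ (deg i * deg j) • (x k deg j * (if i = r then 1 else 0) +
        (if j = r then 1 else 0) * ((-1 : k) ^ (deg r * deg i) • x k deg i)) := by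
      by_cases hi : i = r <;> by_cases hj : j = r
      · subst hi; subst hj
        simp [smul_add, smul_smul, s1, add_comm]
      · subst hi
        simp [hj]
      · subst hj
        simp [hi, smul_smul, mul_comm (deg j) (deg i), s1]
      · simp [hi, hj]
    have h11 : ((-1 : k) ^ (deg r * deg i) • x k deg i) *
        ((-1 : k) ^ (deg r * deg j) • x k deg j) =
        (-1 : k) ^ (deg i * deg j) • (((-1 : k) ^ (deg r * deg j) • x k deg j) *
        ((-1 : k) ^ (deg r * deg i) • x k deg i)) := by
      simp only [smul_mul_smul_comm, e, smul_smul]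
      congr 1
      ring
    rw [h01, h11]
    simp [e])

/-- The anti-differential `ψ_r : R → R`. -/
def psi (r : Fin n) : Poly k deg →ₗ[k] Poly k deg where
  toFun a := psiMatrix r a 0 1
  map_add' := by simp
  map_smul' := by simp

/-- `ψ_r(x_s) = δ_{rs}`. -/
theorem psi_x (r s : Fin n) : psi r (x k deg s) = if s = r then 1 else 0 := by
  simp [psi, psiMatrix]

theorem psiMatrix_apply (r : Fin n) (l : List (Fin n)) :
    psiMatrix r (l.map (x k deg)).prod 0 0 = (l.map (x k deg)).prod ∧
    psiMatrix r (l.map (x k deg)).prod 1 0 = 0 ∧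
    psiMatrix r (l.map (x k deg)).prod 1 1 =
      (-1 : k) ^ (deg r * (l.map deg).sum) • (l.map (x k deg)).prod ∧
    psiMatrix r (l.map (x k deg)).prod 0 1 ∈ grading k deg ((l.map deg).sum - deg r) := by
  induction l with
  | nil => simp
  | cons s l ih =>
    obtain ⟨h00, h10, h11, h01⟩ := ih
    simp only [List.map_cons, List.prod_cons, map_mul, List.sum_cons, Matrix.mul_apply,
      Fin.sum_univ_two, h00, h10, h11]
    have hx : psiMatrix r (x k deg s) = _ := lift_x _ _ s
    rw [hx]
    refine ⟨by simp, by simp, ?_, ?_⟩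
    · simp [smul_smul, mul_add, zpow_add₀, mul_comm]
    · simp only [Matrix.of_apply, Matrix.cons_val', Matrix.cons_val_zero, Matrix.cons_val_one,
        Matrix.cons_val_fin_one]
      refine Submodule.add_mem _ ?_ ?_
      · rw [add_sub_assoc]
        exact SetLike.mul_mem_graded (gen_mem (k := k) (x k deg) deg s) h01
      · split_ifs with h
        · subst h
          simp only [one_mul, add_sub_cancel_left]
          exact Submodule.smul_mem _ _ (Submodule.subset_span ⟨l, rfl, rfl⟩)
        · simp

theorem psiMatrix_of_mem (r : Fin n) {p : ℤ} {a : Poly k deg} (ha : a ∈ grading k deg p) :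
    psiMatrix r a 0 0 = a ∧ psiMatrix r a 1 1 = (-1 : k) ^ (deg r * p) • a ∧
      psi r a ∈ grading k deg (p - deg r) := by
  change _ ∧ _ ∧ psiMatrix r a 0 1 ∈ _
  induction ha using Submodule.span_induction with
  | mem a h =>
    obtain ⟨l, rfl, rfl⟩ := h
    obtain ⟨h00, -, h11, h01⟩ := psiMatrix_apply (k := k) (deg := deg) r l
    exact ⟨h00, h11, h01⟩
  | zero => simp
  | add a b _ _ iha ihb =>
    simp only [map_add, Matrix.add_apply, iha.1, ihb.1, iha.2.1, ihb.2.1, smul_add, true_and]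
    exact Submodule.add_mem _ iha.2.2 ihb.2.2
  | smul c a _ iha =>
    simp only [map_smul, Matrix.smul_apply, iha.1, iha.2.1, true_and]
    exact ⟨smul_comm _ _ _, Submodule.smul_mem _ _ iha.2.2⟩

theorem word_comm (i : Fin n) (l : List (Fin n)) :
    x k deg i * (l.map (x k deg)).prod =
      (-1 : k) ^ (deg i * (l.map deg).sum) • ((l.map (x k deg)).prod * x k deg i) := by
  induction l with
  | nil => simp
  | cons j l ih =>
    rw [List.map_cons, List.map_cons, List.prod_cons, List.sum_cons, ← mul_assoc, x_comm,
      smul_mul_assoc, mul_assoc, ih, mul_smul_comm, smul_smul, mul_add,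
      zpow_add₀ (by simp : (-1 : k) ≠ 0), mul_assoc]

/-- `R` is graded commutative. -/
theorem graded_comm {p q : ℤ} {a b : Poly k deg} (ha : a ∈ grading k deg p)
    (hb : b ∈ grading k deg q) : a * b = (-1 : k) ^ (p * q) • (b * a) := by
  induction ha using Submodule.span_induction with
  | mem a h =>
    obtain ⟨l, rfl, rfl⟩ := h
    induction hb using Submodule.span_induction with
    | mem b h =>
      obtain ⟨l', rfl, rfl⟩ := h
      induction l with
      | nil => simp
      | cons i l ih =>
        rw [List.map_cons, List.map_cons, List.prod_cons, List.sum_cons, mul_assoc, ih,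
          mul_smul_comm, ← mul_assoc, word_comm, smul_mul_assoc, smul_smul, add_mul,
          zpow_add₀ (by simp : (-1 : k) ≠ 0), mul_assoc, mul_comm ((-1 : k) ^ _)]
    | zero => simp
    | add b c _ _ ihb ihc => rw [mul_add, add_mul, smul_add, ihb, ihc]
    | smul c b _ ihb => rw [mul_smul_comm, smul_mul_assoc, ihb, smul_comm]
  | zero => simp
  | add a c _ _ iha ihc => rw [mul_add, add_mul, smul_add, iha, ihc]
  | smul c a _ iha => rw [mul_smul_comm, smul_mul_assoc, iha, smul_comm]

/-- `ψ_r(ab) = a ψ_r(b) + (-1)^{|a||b|} b ψ_r(a)`. -/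
theorem psi_mul (r : Fin n) {p q : ℤ} {a b : Poly k deg} (ha : a ∈ grading k deg p)
    (hb : b ∈ grading k deg q) :
    psi r (a * b) = a * psi r b + (-1 : k) ^ (p * q) • (b * psi r a) := by
  obtain ⟨h00, -, hψ⟩ := psiMatrix_of_mem r ha
  obtain ⟨-, h11, -⟩ := psiMatrix_of_mem r hb
  have h : psi r (a * b) = psiMatrix r a 0 0 * psi r b + psi r a * psiMatrix r b 1 1 := by
    change psiMatrix r (a * b) 0 1 = _
    rw [map_mul, Matrix.mul_apply, Fin.sum_univ_two]
    rfl
  rw [h, h00, h11, graded_comm hb hψ, mul_smul_comm, smul_smul]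
  congr 2
  have e : p * q + q * (p - deg r) = (q * (p - deg r) + q * (p - deg r)) + deg r * q := by ring
  rw [← zpow_add₀ (by simp : (-1 : k) ≠ 0), e, zpow_add₀ (by simp : (-1 : k) ≠ 0),
    zpow_add₀ (by simp : (-1 : k) ≠ 0), sign_mul_self, one_mul]

end Poly

end Poly

/-! ### The free extension `F(R) = R⟨y_1, …, y_n⟩` -/

section FreeExt

variable (k : Type*) [Field k] {n : ℕ} (deg : Fin n → ℤ)

/-- Among the free generators `x_i = inl i`, `y_i = inr i`, only the defining relations of `R` are
imposed on the `x_i`. -/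
inductive FreeExtRel : FreeAlgebra k (Fin n ⊕ Fin n) → FreeAlgebra k (Fin n ⊕ Fin n) → Prop
  | comm (i j : Fin n) : FreeExtRel
      (FreeAlgebra.ι k (Sum.inl i) * FreeAlgebra.ι k (Sum.inl j))
      ((-1 : k) ^ (deg i * deg j) •
        (FreeAlgebra.ι k (Sum.inl j) * FreeAlgebra.ι k (Sum.inl i)))

/-- `F(R) = R⟨y_1, …, y_n⟩`, the algebra obtained from `R` by freely adjoining noncommuting
indeterminates `y_i`, which do not commute with `R` either. -/
def FreeExt : Type _ := RingQuot (FreeExtRel k deg)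

instance : Ring (FreeExt k deg) := inferInstanceAs (Ring (RingQuot (FreeExtRel k deg)))
instance : Algebra k (FreeExt k deg) :=
  inferInstanceAs (Algebra k (RingQuot (FreeExtRel k deg)))

namespace FreeExt

/-- The projection from the free algebra on the `x_i` and `y_i`. -/
def mk : FreeAlgebra k (Fin n ⊕ Fin n) →ₐ[k] FreeExt k deg :=
  RingQuot.mkAlgHom k (FreeExtRel k deg)

/-- The generator `x_i` of `F(R)`. -/
def x (i : Fin n) : FreeExt k deg := mk k deg (FreeAlgebra.ι k (Sum.inl i))

/-- The generator `y_i` of `F(R)`. -/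
def y (i : Fin n) : FreeExt k deg := mk k deg (FreeAlgebra.ι k (Sum.inr i))

variable {k deg}

theorem x_comm (i j : Fin n) :
    x k deg i * x k deg j = (-1 : k) ^ (deg i * deg j) • (x k deg j * x k deg i) := by
  have h : mk k deg _ = mk k deg _ :=
    RingQuot.mkAlgHom_rel k (FreeExtRel.comm (k := k) (deg := deg) i j)
  rwa [map_smul, map_mul, map_mul] at h

/-- The canonical map `R → F(R)`. -/
def incl : Poly k deg →ₐ[k] FreeExt k deg := Poly.lift (x k deg) x_comm

/-- `ψ : R → F(R)`, `ψ(f) = ∑_r ψ_r(f) y_r`. -/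
def psi : Poly k deg →ₗ[k] FreeExt k deg :=
  ∑ r, LinearMap.mulRight k (y k deg r) ∘ₗ incl.toLinearMap ∘ₗ Poly.psi r

theorem psi_apply (f : Poly k deg) : psi f = ∑ r, incl (Poly.psi r f) * y k deg r := by
  simp [psi]

/-- The universal property of `F(R)`. -/
def lift {B : Type*} [Ring B] [Algebra k B] (g h : Fin n → B)
    (hg : ∀ i j, g i * g j = (-1 : k) ^ (deg i * deg j) • (g j * g i)) : FreeExt k deg →ₐ[k] B :=
  RingQuot.liftAlgHom k ⟨FreeAlgebra.lift k (Sum.elim g h), by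
    rintro _ _ ⟨i, j⟩
    simpa using hg i j⟩

@[simp] theorem lift_x {B : Type*} [Ring B] [Algebra k B] (g h : Fin n → B)
    (hg : ∀ i j, g i * g j = (-1 : k) ^ (deg i * deg j) • (g j * g i)) (i : Fin n) :
    lift g h hg (x k deg i) = g i :=
  (RingQuot.liftAlgHom_mkAlgHom_apply k _ _ _).trans (FreeAlgebra.lift_ι_apply _ _)

@[simp] theorem lift_y {B : Type*} [Ring B] [Algebra k B] (g h : Fin n → B)
    (hg : ∀ i j, g i * g j = (-1 : k) ^ (deg i * deg j) • (g j * g i)) (i : Fin n) :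
    lift g h hg (y k deg i) = h i :=
  (RingQuot.liftAlgHom_mkAlgHom_apply k _ _ _).trans (FreeAlgebra.lift_ι_apply _ _)

theorem hom_ext {B : Type*} [Ring B] [Algebra k B] {φ φ' : FreeExt k deg →ₐ[k] B}
    (hx : ∀ i, φ (x k deg i) = φ' (x k deg i)) (hy : ∀ i, φ (y k deg i) = φ' (y k deg i)) :
    φ = φ' := by
  apply RingQuot.ringQuot_ext'
  apply FreeAlgebra.hom_ext
  funext i
  cases i with
  | inl i => exact hx i
  | inr i => exact hy i

end FreeExt

end FreeExt

/-! ### The universal enveloping algebra `R^e = F(R) / J` -/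

section Env

variable {k : Type*} [Field k] {n : ℕ} {deg : Fin n → ℤ}

/-- The relations generating the ideal `J` of `F(R)`. -/
inductive EnvRel (P : DGPoissonStructure (Poly.grading k deg)) :
    FreeExt k deg → FreeExt k deg → Prop
  | yy (i j : Fin n) : EnvRel P
      (FreeExt.y k deg i * FreeExt.y k deg j -
        (-1 : k) ^ (deg i * deg j) • (FreeExt.y k deg j * FreeExt.y k deg i) -
        FreeExt.psi (P.bracket (Poly.x k deg i) (Poly.x k deg j))) 0
  | yx (i j : Fin n) : EnvRel P
      (FreeExt.y k deg i * FreeExt.x k deg j -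
        (-1 : k) ^ (deg i * deg j) • (FreeExt.x k deg j * FreeExt.y k deg i) -
        FreeExt.incl (P.bracket (Poly.x k deg i) (Poly.x k deg j))) 0

variable (P : DGPoissonStructure (Poly.grading k deg))

/-- The universal enveloping algebra `R^e` of the DG Poisson algebra `R`. -/
def Env : Type _ := RingQuot (EnvRel P)

instance : Ring (Env P) := inferInstanceAs (Ring (RingQuot (EnvRel P)))
instance : Algebra k (Env P) := inferInstanceAs (Algebra k (RingQuot (EnvRel P)))

namespace Env

/-- The canonical projection `π : F(R) → R^e`. -/
def mk : FreeExt k deg →ₐ[k] Env P := RingQuot.mkAlgHom k (EnvRel P)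

/-- The canonical algebra map `R → R^e`. -/
def m : Poly k deg →ₐ[k] Env P := (mk P).comp FreeExt.incl

/-- The canonical linear map `h : R → R^e`, `h(f) = ∑_r ψ_r(f) y_r`. -/
def h : Poly k deg →ₗ[k] Env P := (mk P).toLinearMap ∘ₗ FreeExt.psi

/-- The image of `x_i` in `R^e`. -/
def x (i : Fin n) : Env P := m P (Poly.x k deg i)

/-- The image of `y_i` in `R^e`. -/
def y (i : Fin n) : Env P := mk P (FreeExt.y k deg i)

/-- `R^e` as a left `R`-module: `f • u = f u`. -/
instance : Module (Poly k deg) (Env P) := Module.compHom (Env P) (m P).toRingHom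

/-- `R^e` as a right `R`-module: `op f • u = u f`. -/
instance : Module (Poly k deg)ᵐᵒᵖ (Env P) := Module.compHom (Env P) (m P).toRingHom.op

theorem smul_def (f : Poly k deg) (u : Env P) : f • u = m P f * u := rfl

theorem op_smul_def (f : Poly k deg) (u : Env P) : op f • u = u * m P f := rfl

/-- The homogeneous elements of degree `p` of `R^e`, where `|x_i| = |y_i| = deg i`. -/
abbrev grading : ℤ → Submodule k (Env P) :=
  wordGrading k (Sum.elim (x P) (y P)) (Sum.elim deg deg)

variable {P}

theorem mk_x (i : Fin n) : mk P (FreeExt.x k deg i) = x P i := by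
  simp [x, m, FreeExt.incl]

theorem y_mul_y (i j : Fin n) : y P i * y P j =
    (-1 : k) ^ (deg i * deg j) • (y P j * y P i) +
      h P (P.bracket (Poly.x k deg i) (Poly.x k deg j)) := by
  have e : mk P _ = mk P 0 := RingQuot.mkAlgHom_rel k (EnvRel.yy (P := P) i j)
  rw [map_sub, map_sub, map_smul, map_mul, map_mul, map_zero, sub_sub, sub_eq_zero] at e
  exact e

theorem y_mul_x (i j : Fin n) : y P i * x P j =
    (-1 : k) ^ (deg i * deg j) • (x P j * y P i) +
      m P (P.bracket (Poly.x k deg i) (Poly.x k deg j)) := by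
  have e : mk P _ = mk P 0 := RingQuot.mkAlgHom_rel k (EnvRel.yx (P := P) i j)
  rw [map_sub, map_sub, map_smul, map_mul, map_mul, map_zero, sub_sub, sub_eq_zero, mk_x] at e
  exact e

theorem x_comm (i j : Fin n) : x P i * x P j = (-1 : k) ^ (deg i * deg j) • (x P j * x P i) := by
  simp only [x, ← map_mul, ← map_smul, Poly.x_comm i j]

theorem x_mem (i : Fin n) : x P i ∈ grading P (deg i) :=
  gen_mem (k := k) (Sum.elim (x P) (y P)) (Sum.elim deg deg) (Sum.inl i)

theorem y_mem (i : Fin n) : y P i ∈ grading P (deg i) :=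
  gen_mem (k := k) (Sum.elim (x P) (y P)) (Sum.elim deg deg) (Sum.inr i)

theorem m_mem {p : ℤ} {f : Poly k deg} (hf : f ∈ Poly.grading k deg p) :
    m P f ∈ grading P p := by
  induction hf using Submodule.span_induction with
  | mem a ha =>
    obtain ⟨l, rfl, rfl⟩ := ha
    refine Submodule.subset_span ⟨l.map Sum.inl, ?_, ?_⟩
    · rw [List.map_map]; rfl
    · rw [List.map_map, map_list_prod, List.map_map]; rfl
  | zero => simp
  | add a b _ _ iha ihb => rw [map_add]; exact Submodule.add_mem _ iha ihb
  | smul c a _ iha => rw [map_smul]; exact Submodule.smul_mem _ _ iha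

/-- The map from `F(R)` to the direct sum of the homogeneous parts of `R^e`. -/
def preDecompose (P : DGPoissonStructure (Poly.grading k deg)) :
    FreeExt k deg →ₐ[k] DirectSum ℤ fun p => grading P p :=
  FreeExt.lift
    (fun i => DirectSum.of (fun p => grading P p) (deg i) ⟨x P i, x_mem i⟩)
    (fun i => DirectSum.of (fun p => grading P p) (deg i) ⟨y P i, y_mem i⟩)
    (by
      intro i j
      rw [DirectSum.of_mul_of, DirectSum.of_mul_of]
      change _ = (-1 : k) ^ (deg i * deg j) • DirectSum.lof k ℤ (fun p => grading P p) _ _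
      rw [← map_smul]
      refine DirectSum.of_eq_of_gradedMonoid_eq (Sigma.subtype_ext (add_comm _ _) ?_)
      exact x_comm i j)

theorem coe_preDecompose (z : FreeExt k deg) :
    DirectSum.coeAlgHom (grading P) (preDecompose P z) = mk P z := by
  have h : (DirectSum.coeAlgHom (grading P)).comp (preDecompose P) = mk P :=
    FreeExt.hom_ext (fun i => by simp [preDecompose, mk_x])
      (fun i => by simp [preDecompose]; rfl)
  exact DFunLike.congr_fun h z

/-- The elements of the direct sum that are concentrated in degree `p`. -/
abbrev conc (P : DGPoissonStructure (Poly.grading k deg)) (p : ℤ) :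
    Submodule k (DirectSum ℤ fun p => grading P p) :=
  LinearMap.range (DirectSum.lof k ℤ (fun p => grading P p) p)

theorem conc_mul {p q : ℤ} {a b : DirectSum ℤ fun p => grading P p} (ha : a ∈ conc P p)
    (hb : b ∈ conc P q) : a * b ∈ conc P (p + q) := by
  obtain ⟨u, rfl⟩ := ha
  obtain ⟨v, rfl⟩ := hb
  exact ⟨_, (DirectSum.of_mul_of (A := fun p => grading P p) u v).symm⟩

theorem preDecompose_x (i : Fin n) : preDecompose P (FreeExt.x k deg i) ∈ conc P (deg i) :=
  ⟨⟨x P i, x_mem i⟩, by rw [preDecompose, FreeExt.lift_x]; rfl⟩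

theorem preDecompose_y (i : Fin n) : preDecompose P (FreeExt.y k deg i) ∈ conc P (deg i) :=
  ⟨⟨y P i, y_mem i⟩, by rw [preDecompose, FreeExt.lift_y]; rfl⟩

theorem preDecompose_incl {p : ℤ} {f : Poly k deg} (hf : f ∈ Poly.grading k deg p) :
    preDecompose P (FreeExt.incl f) ∈ conc P p := by
  induction hf using Submodule.span_induction with
  | mem a ha =>
    obtain ⟨l, rfl, rfl⟩ := ha
    induction l with
    | nil => simp only [List.map_nil, List.prod_nil, List.sum_nil, map_one]; exact ⟨_, rfl⟩
    | cons i l ih =>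
      simp only [List.map_cons, List.prod_cons, List.sum_cons, map_mul]
      refine conc_mul ?_ ih
      rw [FreeExt.incl, Poly.lift_x]
      exact preDecompose_x i
  | zero => simp only [map_zero]; exact Submodule.zero_mem _
  | add a b _ _ iha ihb => simp only [map_add]; exact Submodule.add_mem _ iha ihb
  | smul c a _ iha => simp only [map_smul]; exact Submodule.smul_mem _ _ iha

theorem preDecompose_psi {p : ℤ} {f : Poly k deg} (hf : f ∈ Poly.grading k deg p) :
    preDecompose P (FreeExt.psi f) ∈ conc P p := by
  rw [FreeExt.psi_apply, map_sum]
  refine Submodule.sum_mem _ fun r _ => ?_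
  rw [map_mul]
  have h := conc_mul (preDecompose_incl (P := P) (Poly.psiMatrix_of_mem r hf).2.2)
    (preDecompose_y r)
  rwa [sub_add_cancel] at h

theorem eq_zero_of_conc {p : ℤ} {z : FreeExt k deg} (hz : preDecompose P z ∈ conc P p)
    (h0 : mk P z = 0) : preDecompose P z = 0 := by
  obtain ⟨u, hu⟩ := hz
  rw [← coe_preDecompose, ← hu, DirectSum.lof_eq_of, DirectSum.coeAlgHom_of] at h0
  rw [← hu, (Subtype.ext h0 : u = 0), map_zero]

theorem conc_sub {p q : ℤ} {c : k} {a b z : FreeExt k deg} (ha : preDecompose P a ∈ conc P p)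
    (hb : preDecompose P b ∈ conc P q) (hz : preDecompose P z ∈ conc P (p + q)) :
    preDecompose P (a * b - c • (b * a) - z) ∈ conc P (p + q) := by
  have h1 := conc_mul ha hb
  have h2 := conc_mul hb ha
  rw [add_comm q p] at h2
  have e : a * b - c • (b * a) - z = a * b + (-c) • (b * a) + (-1 : k) • z := by
    rw [neg_smul, neg_smul, one_smul]; abel
  rw [e, map_add, map_add, map_smul, map_smul, map_mul, map_mul]
  exact Submodule.add_mem _ (Submodule.add_mem _ h1 (Submodule.smul_mem _ _ h2))
    (Submodule.smul_mem _ _ hz)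

theorem preDecompose_rel {a b : FreeExt k deg} (hab : EnvRel P a b) :
    preDecompose P a = preDecompose P b := by
  have h0 : mk P a = mk P b := RingQuot.mkAlgHom_rel k hab
  have hx (i : Fin n) := gen_mem (k := k) (Poly.x k deg) deg i
  cases hab with
  | yy i j =>
    rw [map_zero] at h0 ⊢
    exact eq_zero_of_conc (conc_sub (preDecompose_y i) (preDecompose_y j)
      (preDecompose_psi (P.bracket_mem _ _ _ (hx i) _ (hx j)))) h0
  | yx i j =>
    rw [map_zero] at h0 ⊢
    exact eq_zero_of_conc (conc_sub (preDecompose_y i) (preDecompose_x j)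
      (preDecompose_incl (P.bracket_mem _ _ _ (hx i) _ (hx j)))) h0

/-- The decomposition of `R^e` into homogeneous components. -/
def decomposeHom (P : DGPoissonStructure (Poly.grading k deg)) :
    Env P →ₐ[k] DirectSum ℤ fun p => grading P p :=
  RingQuot.liftAlgHom k ⟨preDecompose P, fun _ _ hab => preDecompose_rel hab⟩

theorem decomposeHom_mk (z : FreeExt k deg) : decomposeHom P (mk P z) = preDecompose P z :=
  RingQuot.liftAlgHom_mkAlgHom_apply k _ _ _

theorem hom_ext {B : Type*} [Ring B] [Algebra k B] {φ φ' : Env P →ₐ[k] B}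
    (h : ∀ z, φ (mk P z) = φ' (mk P z)) : φ = φ' := by
  apply RingQuot.ringQuot_ext'
  exact AlgHom.ext h

/-- `R^e` is a graded algebra. -/
instance : GradedAlgebra (grading P) :=
  GradedAlgebra.ofAlgHom (grading P) (decomposeHom P)
    (hom_ext fun z => by
      rw [AlgHom.comp_apply, decomposeHom_mk, coe_preDecompose, AlgHom.id_apply])
    (fun p a => hom_word_eq (Sum.elim (x P) (y P)) (Sum.elim deg deg) (decomposeHom P)
      (fun i => by
        cases i with
        | inl i =>
          change decomposeHom P (x P i) = _
          rw [← mk_x, decomposeHom_mk, preDecompose, FreeExt.lift_x]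
          rfl
        | inr i =>
          change decomposeHom P (mk P (FreeExt.y k deg i)) = _
          rw [decomposeHom_mk, preDecompose, FreeExt.lift_y]
          rfl) p a)

end Env

/-- The exponents of the monomials: `J_r ∈ ℕ`, with `J_r ≤ 1` where `|x_r|` is odd and `2 ≠ 0` in
`k` (so that `x_r ^ 2 = 0` in `R`). -/
def Exponent (k : Type*) [Field k] {n : ℕ} (deg : Fin n → ℤ) : Type :=
  {J : Fin n → ℕ // ∀ r, Odd (deg r) → (2 : k) ≠ 0 → J r ≤ 1}

end Env

end DGPoisson

/-!
Write `R^e` for the enveloping algebra. Every element of `R^e` is a combination of the standard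
monomials `y^J` with coefficients in `R` on the left, since the relations sort a product of `y_i`
up to shorter products. To see that these monomials are independent, one lets `R^e` act on the free
left `R`-module on the standard words: the operator of `y_i` is defined by recursion on the length
of the word it is applied to, exactly as the relations dictate, so that `[y_i, f] = {x_i, f}` for
`f` in `R`. What has to be checked is `[y_i, y_j] = ψ({x_i, x_j})`. The defect of this relation
behaves like the curvature of a connection. It commutes with `R` up to signs, vanishes by
construction when it meets a word in the right order, and satisfies a Bianchi identity, which
expresses that both commutators and the bracket satisfy the Jacobi identity; so it vanishes by
induction on the length of the word. For odd `x_i` the value of `y_i^2` is obtained from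
`[y_i, y_i]` on division by `2`, and for the defect of `[y_i, y_i]` to vanish on `y_i w` one needs
`{x_i, {x_i, x_i}} = 0`, which follows from the Jacobi identity on division by `3`; this is where
characteristic `2` and `3` are special.

Moving coefficients from one side of `y^J` to the other is triangular with respect to the length,
with sign automorphisms of `R` on the diagonal, so the `y^J` are a basis on the right as well.
The ordered monomials are a basis of `R` itself because they are the image of the `y^J` in the
enveloping algebra of the zero bracket.

For the differential, a derivation `δ` of degree `1` is the same as an algebra map
`a ↦ !![(-1)^{|a|} a, δ(a); 0, a]` into upper triangular matrices, so it suffices to prescribe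
`δ` on the generators and to check the relations.
-/

namespace DGPoisson

section Sign

variable {k : Type*} [Field k]

theorem neg_one_zpow_cases (p : ℤ) : (-1 : k) ^ p = 1 ∨ (-1 : k) ^ p = -1 := by
  rcases Int.even_or_odd p with h | h
  · exact Or.inl h.neg_one_zpow
  · exact Or.inr h.neg_one_zpow

theorem neg_one_zpow_add (p q : ℤ) : (-1 : k) ^ (p + q) = (-1) ^ p * (-1) ^ q :=
  zpow_add₀ (by simp) _ _

theorem neg_one_zpow_mul_mul_neg_one_zpow (p q r : ℤ) :
    (-1 : k) ^ (p * q) * (-1) ^ (q * (p + r)) = (-1) ^ (q * r) := by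
  rw [mul_add, neg_one_zpow_add, mul_comm q p, ← mul_assoc, Poly.sign_mul_self, one_mul]

end Sign

section WordGrading

variable {k : Type*} [Field k] {A : Type*} [Ring A] [Algebra k A] {ι : Type*}

@[elab_as_elim]
theorem wordGrading_induction {g : ι → A} {w : ι → ℤ}
    {Q : ∀ (p : ℤ) (a : A), a ∈ wordGrading k g w p → Prop}
    (one : Q 0 1 SetLike.GradedOne.one_mem)
    (gen_mul : ∀ i p a (ha : a ∈ wordGrading k g w p), Q p a ha →
      Q (w i + p) (g i * a) (SetLike.mul_mem_graded (gen_mem g w i) ha))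
    (zero : ∀ p, Q p 0 (Submodule.zero_mem _))
    (add : ∀ p a b (ha : a ∈ wordGrading k g w p) (hb : b ∈ wordGrading k g w p),
      Q p a ha → Q p b hb → Q p (a + b) (Submodule.add_mem _ ha hb))
    (smul : ∀ p (c : k) a (ha : a ∈ wordGrading k g w p), Q p a ha →
      Q p (c • a) (Submodule.smul_mem _ c ha))
    {p : ℤ} {a : A} (ha : a ∈ wordGrading k g w p) : Q p a ha := by
  induction ha using Submodule.span_induction with
  | mem a h =>
    obtain ⟨l, rfl, rfl⟩ := h
    induction l with
    | nil => exact one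
    | cons i l ih => exact gen_mul i _ _ _ ih
  | zero => exact zero p
  | add a b ha hb iha ihb => exact add p a b ha hb iha ihb
  | smul c a ha iha => exact smul p c a ha iha

end WordGrading

section SuperCommutator

variable (k : Type*) [Field k] {A : Type*} [Ring A] [Algebra k A]

/-- The graded commutator `[u, v] = u v - (-1) ^ (p q) v u`, where `p` and `q` are the degrees
attributed to `u` and `v`. -/
def superCommutator (p q : ℤ) : A →ₗ[k] A →ₗ[k] A :=
  LinearMap.mul k A - (-1 : k) ^ (p * q) • (LinearMap.mul k A).flip

theorem superCommutator_apply (p q : ℤ) (u v : A) :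
    superCommutator k p q u v = u * v - (-1 : k) ^ (p * q) • (v * u) := rfl

theorem mul_eq_smul_mul_add_superCommutator (p q : ℤ) (u v : A) :
    u * v = (-1 : k) ^ (p * q) • (v * u) + superCommutator k p q u v := by
  rw [superCommutator_apply, add_sub_cancel]

theorem map_superCommutator {B : Type*} [Ring B] [Algebra k B] (φ : A →ₐ[k] B) (p q : ℤ)
    (u v : A) : φ (superCommutator k p q u v) = superCommutator k p q (φ u) (φ v) := by
  simp only [superCommutator_apply, map_sub, map_smul, map_mul]

theorem superCommutator_swap (p q : ℤ) (u v : A) :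
    superCommutator k p q u v = -((-1 : k) ^ (p * q) • superCommutator k q p v u) := by
  simp only [superCommutator_apply, smul_sub, smul_smul, mul_comm q p, Poly.sign_mul_self,
    one_smul, neg_sub]

theorem superCommutator_mul_right (p q r : ℤ) (u v w : A) :
    superCommutator k p (q + r) u (v * w) =
      superCommutator k p q u v * w + (-1 : k) ^ (p * q) • (v * superCommutator k p r u w) := by
  simp only [superCommutator_apply, mul_add, neg_one_zpow_add, sub_mul, mul_sub, smul_sub,
    smul_mul_assoc, mul_smul_comm, smul_smul, mul_assoc]
  abel

theorem superCommutator_mul_left (p q r : ℤ) (u v w : A) :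
    superCommutator k (p + q) r (u * v) w =
      u * superCommutator k q r v w + (-1 : k) ^ (q * r) • (superCommutator k p r u w * v) := by
  simp only [superCommutator_apply, add_mul, neg_one_zpow_add, sub_mul, mul_sub, smul_sub,
    smul_mul_assoc, mul_smul_comm, smul_smul, mul_assoc, mul_comm ((-1 : k) ^ (p * r))]
  abel

theorem superCommutator_jacobi (p q r : ℤ) (u v w : A) :
    superCommutator k p (q + r) u (superCommutator k q r v w) =
      superCommutator k (p + q) r (superCommutator k p q u v) w +
        (-1 : k) ^ (p * q) • superCommutator k q (p + r) v (superCommutator k p r u w) := by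
  rw [superCommutator_apply k q r v w, map_sub, map_smul, superCommutator_mul_right, add_comm q r,
    superCommutator_mul_right, mul_eq_smul_mul_add_superCommutator k (p + q) r
      (superCommutator k p q u v) w, mul_eq_smul_mul_add_superCommutator k q (p + r) v
      (superCommutator k p r u w)]
  simp only [smul_add, smul_smul, mul_add, add_mul, neg_one_zpow_add, mul_comm q p]
  rcases neg_one_zpow_cases (k := k) (p * q) with hpq | hpq <;>
  rcases neg_one_zpow_cases (k := k) (q * r) with hqr | hqr <;>
  simp only [hpq, hqr, one_smul, neg_smul, one_mul, neg_mul, mul_one, mul_neg, neg_neg] <;> abel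

end SuperCommutator

namespace Poly

variable {k : Type*} [Field k] {n : ℕ} {deg : Fin n → ℤ}

theorem x_mem (i : Fin n) : x k deg i ∈ grading k deg (deg i) := gen_mem _ _ i

/-- The automorphism `a ↦ (-1)^{|x_i||a|} a`, which records the sign of moving `x_i` past `a`. -/
def twist (i : Fin n) : Poly k deg →ₐ[k] Poly k deg :=
  lift (fun s => (-1 : k) ^ (deg i * deg s) • x k deg s) fun r s => by
    rw [smul_mul_smul_comm, smul_mul_smul_comm, x_comm r s, smul_smul, smul_smul]
    congr 1
    ring

theorem twist_of_mem (i : Fin n) {p : ℤ} {a : Poly k deg} (ha : a ∈ grading k deg p) :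
    twist i a = (-1 : k) ^ (deg i * p) • a := by
  induction ha using wordGrading_induction with
  | one => simp
  | gen_mul j p a _ ih =>
    rw [map_mul, ih, twist, lift_x, smul_mul_smul_comm, mul_add, neg_one_zpow_add]
  | zero => simp
  | add p a b _ _ iha ihb => rw [map_add, iha, ihb, smul_add]
  | smul p c a _ ih => rw [map_smul, ih, smul_comm]

theorem twist_involutive (i : Fin n) : Function.Involutive (twist (k := k) (deg := deg) i) := by
  have h : (twist i).comp (twist i) = AlgHom.id k (Poly k deg) :=
    hom_ext fun s => by simp [twist, smul_smul, sign_mul_self]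
  exact DFunLike.congr_fun h

theorem psi_one (r : Fin n) : psi r (1 : Poly k deg) = 0 := by
  simp [psi]

theorem superCommutator_map {A : Type*} [Ring A] [Algebra k A] (ρ : Poly k deg →ₐ[k] A) {p q : ℤ}
    {a b : Poly k deg} (ha : a ∈ grading k deg p) (hb : b ∈ grading k deg q) :
    superCommutator k p q (ρ a) (ρ b) = 0 := by
  rw [superCommutator_apply, ← map_mul, ← map_mul, ← map_smul, graded_comm ha hb, sub_self]

end Poly

namespace DGPoissonStructure

section

variable {k : Type*} [Field k] {A : Type*} [Ring A] [Algebra k A] {𝒜 : ℤ → Submodule k A}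
  [GradedAlgebra 𝒜] (P : DGPoissonStructure 𝒜)

theorem bracket_one {p : ℤ} {a : A} (ha : a ∈ 𝒜 p) :
    P.bracket a 1 = 0 := by
  simpa using P.bracket_mul p 0 0 a ha 1 SetLike.GradedOne.one_mem 1 SetLike.GradedOne.one_mem

theorem one_bracket {p : ℤ} {a : A} (ha : a ∈ 𝒜 p) :
    P.bracket 1 a = 0 := by
  rw [P.antisymm 0 p 1 SetLike.GradedOne.one_mem a ha, P.bracket_one ha, smul_zero, neg_zero]

theorem d_one : P.d 1 = 0 := by
  simpa using P.isDGAlgebra.leibniz 0 1 SetLike.GradedOne.one_mem 1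

theorem mul_bracket {p q r : ℤ} {a b c : A} (ha : a ∈ 𝒜 p)
    (hb : b ∈ 𝒜 q) (hc : c ∈ 𝒜 r) :
    P.bracket (a * b) c = a * P.bracket b c + (-1 : k) ^ (p * q) • (b * P.bracket a c) := by
  rw [P.antisymm (p + q) r _ (SetLike.mul_mem_graded ha hb) c hc,
    P.bracket_mul r p q c hc a ha b hb, P.antisymm q r b hb c hc, P.antisymm p r a ha c hc,
    P.mul_comm _ _ _ (P.bracket_mem r p c hc a ha) _ hb]
  simp only [mul_neg, mul_smul_comm, smul_add, smul_neg, smul_smul, add_mul, neg_one_zpow_add,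
    _root_.mul_comm r p, _root_.mul_comm r q]
  rcases neg_one_zpow_cases (k := k) (p * q) with hpq | hpq <;>
  rcases neg_one_zpow_cases (k := k) (p * r) with hpr | hpr <;>
  rcases neg_one_zpow_cases (k := k) (q * r) with hqr | hqr <;>
  simp [hpq, hpr, hqr, add_comm]

end

variable {k : Type*} [Field k] {n : ℕ} {deg : Fin n → ℤ}
  (P : DGPoissonStructure (Poly.grading k deg))

theorem bracket_x_mul (i : Fin n) (a b : Poly k deg) :
    P.bracket (Poly.x k deg i) (a * b) =
      P.bracket (Poly.x k deg i) a * b + Poly.twist i a * P.bracket (Poly.x k deg i) b := by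
  have h : (LinearMap.mul k (Poly k deg)).compr₂ (P.bracket (Poly.x k deg i)) =
      LinearMap.mul k (Poly k deg) ∘ₗ P.bracket (Poly.x k deg i) +
        (LinearMap.mul k (Poly k deg)).compl₁₂ (Poly.twist i).toLinearMap
          (P.bracket (Poly.x k deg i)) := by
    refine DirectSum.decompose_lhom_ext (Poly.grading k deg) fun p => LinearMap.ext fun a =>
      DirectSum.decompose_lhom_ext (Poly.grading k deg) fun q => LinearMap.ext fun b => ?_
    simp [P.bracket_mul _ p q _ (Poly.x_mem i) a a.2 b b.2, Poly.twist_of_mem i a.2]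
  exact DFunLike.congr_fun (DFunLike.congr_fun h a) b

end DGPoissonStructure

section Hamiltonian

variable {k : Type*} [Field k] {n : ℕ} {deg : Fin n → ℤ}
  {A : Type*} [Ring A] [Algebra k A] (ρ : Poly k deg →ₐ[k] A) (Y : Fin n → A)

/-- The linear map `a ↦ ∑_r ψ_r(a) Y_r`, the only candidate for an image of `h : R → R^e` in an
algebra `A` over `R` in which the elements `Y_i` play the role of the `y_i`. -/
def hamiltonian : Poly k deg →ₗ[k] A :=
  ∑ r, LinearMap.mulRight k (Y r) ∘ₗ ρ.toLinearMap ∘ₗ Poly.psi r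

theorem hamiltonian_apply (a : Poly k deg) :
    hamiltonian ρ Y a = ∑ r, ρ (Poly.psi r a) * Y r := by
  simp [hamiltonian]

theorem hamiltonian_x (i : Fin n) : hamiltonian ρ Y (Poly.x k deg i) = Y i := by
  simp [hamiltonian_apply, Poly.psi_x, apply_ite ρ]

theorem hamiltonian_one : hamiltonian ρ Y 1 = 0 := by
  simp [hamiltonian_apply, Poly.psi_one]

theorem hamiltonian_mul {p q : ℤ} {a b : Poly k deg} (ha : a ∈ Poly.grading k deg p)
    (hb : b ∈ Poly.grading k deg q) :
    hamiltonian ρ Y (a * b) =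
      ρ a * hamiltonian ρ Y b + (-1 : k) ^ (p * q) • (ρ b * hamiltonian ρ Y a) := by
  simp only [hamiltonian_apply, Poly.psi_mul _ ha hb, map_add, map_smul, map_mul, add_mul,
    smul_mul_assoc, Finset.sum_add_distrib, Finset.mul_sum, Finset.smul_sum, mul_assoc]

variable (P : DGPoissonStructure (Poly.grading k deg))

/-- The elements `Y_i` satisfy the relations `[Y_i, x_j] = {x_i, x_j}` of `R^e`, but not
necessarily `[Y_i, Y_j] = ψ({x_i, x_j})`. -/
def IsConnection : Prop :=
  ∀ i j, superCommutator k (deg i) (deg j) (Y i) (ρ (Poly.x k deg j)) =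
    ρ (P.bracket (Poly.x k deg i) (Poly.x k deg j))

/-- The defect of the relation `[H(a), H(b)] = H({a, b})`, where `H` is `hamiltonian ρ Y` and `a`,
`b` are of degrees `p`, `q`. -/
def curvature (p q : ℤ) : Poly k deg →ₗ[k] Poly k deg →ₗ[k] A :=
  (superCommutator k p q).compl₁₂ (hamiltonian ρ Y) (hamiltonian ρ Y) -
    P.bracket.compr₂ (hamiltonian ρ Y)

theorem curvature_apply (p q : ℤ) (a b : Poly k deg) :
    curvature ρ Y P p q a b =
      superCommutator k p q (hamiltonian ρ Y a) (hamiltonian ρ Y b) -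
        hamiltonian ρ Y (P.bracket a b) := rfl

theorem superCommutator_hamiltonian (p q : ℤ) (a b : Poly k deg) :
    superCommutator k p q (hamiltonian ρ Y a) (hamiltonian ρ Y b) =
      hamiltonian ρ Y (P.bracket a b) + curvature ρ Y P p q a b := by
  rw [curvature_apply, add_sub_cancel]

theorem curvature_swap {p q : ℤ} {a b : Poly k deg} (ha : a ∈ Poly.grading k deg p)
    (hb : b ∈ Poly.grading k deg q) :
    curvature ρ Y P p q a b = -((-1 : k) ^ (p * q) • curvature ρ Y P q p b a) := by
  rw [curvature_apply, curvature_apply, P.antisymm p q a ha b hb, superCommutator_swap, map_neg,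
    map_smul, smul_sub, neg_sub]
  abel

/-- The Bianchi identity: the Jacobi identity for commutators minus the one for brackets. -/
theorem curvature_bianchi {p q r : ℤ} {a b c : Poly k deg} (ha : a ∈ Poly.grading k deg p)
    (hb : b ∈ Poly.grading k deg q) (hc : c ∈ Poly.grading k deg r) :
    superCommutator k p (q + r) (hamiltonian ρ Y a) (curvature ρ Y P q r b c) +
        curvature ρ Y P p (q + r) a (P.bracket b c) =
      superCommutator k (p + q) r (curvature ρ Y P p q a b) (hamiltonian ρ Y c) +
        curvature ρ Y P (p + q) r (P.bracket a b) c +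
      (-1 : k) ^ (p * q) •
        (superCommutator k q (p + r) (hamiltonian ρ Y b) (curvature ρ Y P p r a c) +
          curvature ρ Y P q (p + r) b (P.bracket a c)) := by
  have hJ := superCommutator_jacobi k p q r (hamiltonian ρ Y a) (hamiltonian ρ Y b)
    (hamiltonian ρ Y c)
  simp only [superCommutator_hamiltonian ρ Y P, map_add, LinearMap.add_apply,
    P.jacobi p q r a ha b hb c hc, map_smul, smul_add] at hJ
  rw [smul_add, ← sub_eq_zero, ← sub_eq_zero.mpr hJ]
  abel

theorem curvature_mul_hamiltonian_mem {I : Ideal A} (hI : ∀ {p q : ℤ} {a b : Poly k deg},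
      a ∈ Poly.grading k deg p → b ∈ Poly.grading k deg q → curvature ρ Y P p q a b ∈ I)
    {p q r : ℤ} {a b c : Poly k deg} (ha : a ∈ Poly.grading k deg p)
    (hb : b ∈ Poly.grading k deg q) (hc : c ∈ Poly.grading k deg r) :
    curvature ρ Y P p q a b * hamiltonian ρ Y c -
        (-1 : k) ^ (q * r) • (curvature ρ Y P p r a c * hamiltonian ρ Y b) +
      (-1 : k) ^ (p * (q + r)) • (curvature ρ Y P q r b c * hamiltonian ρ Y a) ∈ I := by
  have hmul (u : A) {p q : ℤ} {a b : Poly k deg} (ha : a ∈ Poly.grading k deg p)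
      (hb : b ∈ Poly.grading k deg q) : u * curvature ρ Y P p q a b ∈ I :=
    I.mul_mem_left u (hI ha hb)
  have hsmul (s : k) {u : A} (hu : u ∈ I) : s • u ∈ I := I.smul_of_tower_mem s hu
  have hbianchi := curvature_bianchi ρ Y P ha hb hc
  simp only [superCommutator_apply] at hbianchi
  rw [smul_add, smul_sub, smul_smul, neg_one_zpow_mul_mul_neg_one_zpow]
    at hbianchi
  have hmem := I.sub_mem
    (I.add_mem (hmul (hamiltonian ρ Y a) hb hc) (hI ha (P.bracket_mem q r b hb c hc)))
    (I.add_mem (I.sub_mem (hI (P.bracket_mem p q a ha b hb) hc)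
      (hsmul ((-1) ^ ((p + q) * r)) (hmul (hamiltonian ρ Y c) ha hb)))
      (hsmul ((-1) ^ (p * q)) (I.add_mem (hmul (hamiltonian ρ Y b) ha hc)
        (hI hb (P.bracket_mem p r a ha c hc)))))
  convert hmem using 1
  rw [smul_add, ← sub_eq_zero, ← sub_eq_zero.mpr hbianchi.symm]
  abel

namespace IsConnection

variable {ρ Y P}

theorem superCommutator_map (hY : IsConnection ρ Y P) (i : Fin n) {p : ℤ} {a : Poly k deg}
    (ha : a ∈ Poly.grading k deg p) :
    superCommutator k (deg i) p (Y i) (ρ a) = ρ (P.bracket (Poly.x k deg i) a) := by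
  induction ha using wordGrading_induction with
  | one => simp [P.bracket_one (Poly.x_mem i), superCommutator_apply]
  | gen_mul j p a ha ih =>
    rw [map_mul, superCommutator_mul_right, hY i j, ih,
      P.bracket_mul _ _ p _ (Poly.x_mem i) _ (Poly.x_mem j) a ha, map_add, map_smul, map_mul,
      map_mul]
  | zero => simp
  | add p a b _ _ iha ihb => simp only [map_add, iha, ihb]
  | smul p c a _ ih => simp only [map_smul, ih]

theorem superCommutator_hamiltonian_map (hY : IsConnection ρ Y P) {p q : ℤ} {a b : Poly k deg}
    (ha : a ∈ Poly.grading k deg p) (hb : b ∈ Poly.grading k deg q) :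
    superCommutator k p q (hamiltonian ρ Y a) (ρ b) = ρ (P.bracket a b) := by
  induction ha using wordGrading_induction with
  | one => simp [hamiltonian_one, P.one_bracket hb]
  | gen_mul i p a ha ih =>
    rw [hamiltonian_mul ρ Y (Poly.x_mem i) ha, P.mul_bracket (Poly.x_mem i) ha hb, hamiltonian_x,
      map_add, map_smul, LinearMap.add_apply, LinearMap.smul_apply, superCommutator_mul_left, ih,
      Poly.superCommutator_map ρ (Poly.x_mem i) hb, add_comm (deg i) p, superCommutator_mul_left,
      hY.superCommutator_map i hb, Poly.superCommutator_map ρ ha hb]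
    simp only [zero_mul, smul_zero, add_zero, map_add, map_smul, map_mul]
  | zero => simp
  | add p a c _ _ iha ihc => simp only [map_add, LinearMap.add_apply, iha, ihc]
  | smul p c a _ ih => simp only [map_smul, LinearMap.smul_apply, ih]

theorem superCommutator_curvature_map (hY : IsConnection ρ Y P) {p q r : ℤ}
    {a b c : Poly k deg} (ha : a ∈ Poly.grading k deg p) (hb : b ∈ Poly.grading k deg q)
    (hc : c ∈ Poly.grading k deg r) :
    superCommutator k (p + q) r (curvature ρ Y P p q a b) (ρ c) = 0 := by
  have hJ := superCommutator_jacobi k p q r (hamiltonian ρ Y a) (hamiltonian ρ Y b) (ρ c)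
  rw [hY.superCommutator_hamiltonian_map hb hc, hY.superCommutator_hamiltonian_map ha hc,
    hY.superCommutator_hamiltonian_map ha (P.bracket_mem q r b hb c hc),
    hY.superCommutator_hamiltonian_map hb (P.bracket_mem p r a ha c hc)] at hJ
  rw [curvature_apply, map_sub, LinearMap.sub_apply,
    hY.superCommutator_hamiltonian_map (P.bracket_mem p q a ha b hb) hc, sub_eq_zero,
    ← sub_eq_iff_eq_add.mpr hJ, P.jacobi p q r a ha b hb c hc, map_add, map_smul,
    add_sub_cancel_right]

theorem curvature_mul (hY : IsConnection ρ Y P) {p q r : ℤ} {a b c : Poly k deg}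
    (ha : a ∈ Poly.grading k deg p) (hb : b ∈ Poly.grading k deg q)
    (hc : c ∈ Poly.grading k deg r) :
    curvature ρ Y P p (q + r) a (b * c) =
      (-1 : k) ^ (p * q) • (ρ b * curvature ρ Y P p r a c) +
        (-1 : k) ^ ((p + q) * r) • (ρ c * curvature ρ Y P p q a b) := by
  have hbc : superCommutator k p (q + r) (hamiltonian ρ Y a) (ρ b * hamiltonian ρ Y c) =
      ρ (P.bracket a b) * hamiltonian ρ Y c + (-1 : k) ^ (p * q) • (ρ b *
        superCommutator k p r (hamiltonian ρ Y a) (hamiltonian ρ Y c)) := by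
    rw [superCommutator_mul_right, hY.superCommutator_hamiltonian_map ha hb]
  have hcb : superCommutator k p (q + r) (hamiltonian ρ Y a) (ρ c * hamiltonian ρ Y b) =
      ρ (P.bracket a c) * hamiltonian ρ Y b + (-1 : k) ^ (p * r) • (ρ c *
        superCommutator k p q (hamiltonian ρ Y a) (hamiltonian ρ Y b)) := by
    rw [add_comm q r, superCommutator_mul_right, hY.superCommutator_hamiltonian_map ha hc]
  have hsign : (-1 : k) ^ ((p + q) * r) = (-1) ^ (q * r) * (-1) ^ (p * r) := by
    rw [add_mul, neg_one_zpow_add, mul_comm]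
  rw [curvature_apply, P.bracket_mul p q r a ha b hb c hc, hamiltonian_mul ρ Y hb hc, map_add,
    map_smul, hbc, hcb, map_add, map_smul, hamiltonian_mul ρ Y (P.bracket_mem p q a ha b hb) hc,
    hamiltonian_mul ρ Y hb (P.bracket_mem p r a ha c hc), smul_add, smul_smul, smul_add, smul_smul,
    neg_one_zpow_mul_mul_neg_one_zpow, hsign, curvature_apply, curvature_apply, mul_sub,
    mul_sub, smul_sub, smul_sub]
  abel

theorem curvature_mem (hY : IsConnection ρ Y P) (I : Ideal A)
    (hI : ∀ i j, curvature ρ Y P (deg i) (deg j) (Poly.x k deg i) (Poly.x k deg j) ∈ I)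
    {p q : ℤ} {a b : Poly k deg} (ha : a ∈ Poly.grading k deg p)
    (hb : b ∈ Poly.grading k deg q) : curvature ρ Y P p q a b ∈ I := by
  have extend {p : ℤ} {a : Poly k deg} (ha : a ∈ Poly.grading k deg p)
      (h : ∀ j, curvature ρ Y P p (deg j) a (Poly.x k deg j) ∈ I)
      {q : ℤ} {b : Poly k deg} (hb : b ∈ Poly.grading k deg q) :
      curvature ρ Y P p q a b ∈ I := by
    induction hb using wordGrading_induction with
    | one => simp [curvature_apply, hamiltonian_one, P.bracket_one ha]
    | gen_mul j q b hb ih =>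
      rw [hY.curvature_mul ha (Poly.x_mem j) hb]
      exact I.add_mem (I.smul_of_tower_mem _ (I.mul_mem_left _ ih))
        (I.smul_of_tower_mem _ (I.mul_mem_left _ (h j)))
    | zero => simp
    | add q b c _ _ ihb ihc => rw [map_add]; exact I.add_mem ihb ihc
    | smul q c b _ ih => rw [map_smul]; exact I.smul_of_tower_mem c ih
  refine extend ha (fun j => ?_) hb
  rw [curvature_swap ρ Y P ha (Poly.x_mem j)]
  exact I.neg_mem (I.smul_of_tower_mem _ (extend (Poly.x_mem j) (hI j) ha))

end IsConnection

end Hamiltonian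

section LeibnizMatrix

variable (k : Type*) [Field k] {A : Type*} [Ring A] [Algebra k A]

/-- The matrix recording an element `a` of degree `p` and its value `a'` under a derivation of
degree `1`: the upper right entry of a product of such matrices is given by the graded Leibniz
rule. -/
def leibnizMatrix (p : ℤ) (a a' : A) : Matrix (Fin 2) (Fin 2) A :=
  !![(-1 : k) ^ p • a, a'; 0, a]

theorem leibnizMatrix_mul (p q : ℤ) (a a' b b' : A) :
    leibnizMatrix k p a a' * leibnizMatrix k q b b' =
      leibnizMatrix k (p + q) (a * b) (a' * b + (-1 : k) ^ p • (a * b')) := by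
  simp [leibnizMatrix, neg_one_zpow_add, add_comm, smul_smul]

theorem leibnizMatrix_add (p : ℤ) (a a' b b' : A) :
    leibnizMatrix k p a a' + leibnizMatrix k p b b' = leibnizMatrix k p (a + b) (a' + b') := by
  simp [leibnizMatrix, Matrix.of_add_of]

theorem leibnizMatrix_sub (p : ℤ) (a a' b b' : A) :
    leibnizMatrix k p a a' - leibnizMatrix k p b b' = leibnizMatrix k p (a - b) (a' - b') := by
  simp [leibnizMatrix, Matrix.of_sub_of, smul_sub]

theorem leibnizMatrix_smul (p : ℤ) (c : k) (a a' : A) :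
    c • leibnizMatrix k p a a' = leibnizMatrix k p (c • a) (c • a') := by
  simp [leibnizMatrix, Matrix.smul_of, smul_smul, mul_comm]

theorem leibnizMatrix_zero (p : ℤ) : leibnizMatrix k p (0 : A) 0 = 0 := by
  simpa using (leibnizMatrix_smul k p 0 (0 : A) 0).symm

theorem leibnizMatrix_one : leibnizMatrix k 0 (1 : A) 0 = 1 := by
  simp [leibnizMatrix, Matrix.one_fin_two]

theorem superCommutator_leibnizMatrix (p q : ℤ) (a a' b b' : A) :
    superCommutator k p q (leibnizMatrix k p a a') (leibnizMatrix k q b b') =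
      leibnizMatrix k (p + q) (superCommutator k p q a b)
        (superCommutator k (p + 1) q a' b + (-1 : k) ^ p • superCommutator k p (q + 1) a b') := by
  rw [superCommutator_apply, leibnizMatrix_mul, leibnizMatrix_mul, leibnizMatrix_smul,
    add_comm q p, leibnizMatrix_sub]
  simp only [superCommutator_apply, smul_add, smul_sub, smul_smul, add_mul, mul_add, one_mul,
    mul_one, neg_one_zpow_add]
  rw [mul_left_comm, Poly.sign_mul_self, mul_one]
  congr 1
  abel

variable {k}

/-- The upper right entry of an algebra map into `2 × 2` matrices. -/
def upperRight (Φ : A →ₐ[k] Matrix (Fin 2) (Fin 2) A) : A →ₗ[k] A :=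
  Matrix.entryLinearMap k A 0 1 ∘ₗ Φ.toLinearMap

theorem upperRight_eq_of_eq_leibnizMatrix {Φ : A →ₐ[k] Matrix (Fin 2) (Fin 2) A} {p : ℤ}
    {a b b' : A} (h : Φ a = leibnizMatrix k p b b') : upperRight Φ a = b' := by
  simp [upperRight, h, leibnizMatrix]

section WordGrading

variable {ι : Type*} {g : ι → A} {w : ι → ℤ} {Φ : A →ₐ[k] Matrix (Fin 2) (Fin 2) A}

theorem eq_leibnizMatrix_upperRight
    (hΦ : ∀ i, Φ (g i) = leibnizMatrix k (w i) (g i) (upperRight Φ (g i))) {p : ℤ} {a : A}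
    (ha : a ∈ wordGrading k g w p) : Φ a = leibnizMatrix k p a (upperRight Φ a) := by
  induction ha using wordGrading_induction with
  | one =>
    have h : Φ 1 = leibnizMatrix k 0 1 0 := by rw [map_one, leibnizMatrix_one]
    rwa [upperRight_eq_of_eq_leibnizMatrix h]
  | gen_mul i p a _ ih =>
    have h := (map_mul Φ (g i) a).trans (by rw [hΦ i, ih, leibnizMatrix_mul])
    rwa [upperRight_eq_of_eq_leibnizMatrix h]
  | zero => rw [map_zero, map_zero, leibnizMatrix_zero]
  | add p a b _ _ iha ihb => rw [map_add, iha, ihb, leibnizMatrix_add, map_add]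
  | smul p c a _ ih => rw [map_smul, ih, leibnizMatrix_smul, map_smul]

variable [GradedAlgebra (wordGrading k g w)]

theorem upperRight_mul (hΦ : ∀ i, Φ (g i) = leibnizMatrix k (w i) (g i) (upperRight Φ (g i)))
    {p : ℤ} {a : A} (ha : a ∈ wordGrading k g w p) (b : A) :
    upperRight Φ (a * b) = upperRight Φ a * b + (-1 : k) ^ p • (a * upperRight Φ b) := by
  have h : upperRight Φ ∘ₗ LinearMap.mulLeft k a = LinearMap.mulLeft k (upperRight Φ a) +
      (-1 : k) ^ p • (LinearMap.mulLeft k a ∘ₗ upperRight Φ) := by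
    refine DirectSum.decompose_lhom_ext (wordGrading k g w) fun q => LinearMap.ext fun b => ?_
    refine upperRight_eq_of_eq_leibnizMatrix (p := p + q) (b := a * b) ?_
    rw [LinearMap.mulLeft_apply, Submodule.subtype_apply, map_mul,
      eq_leibnizMatrix_upperRight hΦ ha, eq_leibnizMatrix_upperRight hΦ b.2, leibnizMatrix_mul]
    rfl
  exact DFunLike.congr_fun h b

theorem upperRight_one : upperRight Φ 1 = 0 := by
  simp [upperRight]

theorem upperRight_mem (hΦ : ∀ i, Φ (g i) = leibnizMatrix k (w i) (g i) (upperRight Φ (g i)))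
    (hmem : ∀ i, upperRight Φ (g i) ∈ wordGrading k g w (w i + 1)) {p : ℤ} {a : A}
    (ha : a ∈ wordGrading k g w p) : upperRight Φ a ∈ wordGrading k g w (p + 1) := by
  induction ha using wordGrading_induction with
  | one => simp [upperRight_one]
  | gen_mul i p a ha ih =>
    rw [upperRight_mul hΦ (gen_mem g w i)]
    refine Submodule.add_mem _ ?_ (Submodule.smul_mem _ _ ?_)
    · rw [add_right_comm]
      exact SetLike.mul_mem_graded (hmem i) ha
    · rw [add_assoc]
      exact SetLike.mul_mem_graded (gen_mem g w i) ih
  | zero => simp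
  | add p a b _ _ iha ihb => rw [map_add]; exact Submodule.add_mem _ iha ihb
  | smul p c a _ ih => rw [map_smul]; exact Submodule.smul_mem _ _ ih

theorem isDGAlgebra_upperRight
    (hΦ : ∀ i, Φ (g i) = leibnizMatrix k (w i) (g i) (upperRight Φ (g i)))
    (hmem : ∀ i, upperRight Φ (g i) ∈ wordGrading k g w (w i + 1))
    (hsq : ∀ i, upperRight Φ (upperRight Φ (g i)) = 0) :
    IsDGAlgebra (wordGrading k g w) (upperRight Φ) where
  map_mem _ _ ha := upperRight_mem hΦ hmem ha
  leibniz _ _ ha b := upperRight_mul hΦ ha b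
  sq_zero := by
    have homogeneous {p : ℤ} {a : A} (ha : a ∈ wordGrading k g w p) :
        upperRight Φ (upperRight Φ a) = 0 := by
      induction ha using wordGrading_induction with
      | one => rw [upperRight_one, map_zero]
      | gen_mul i p a _ ih =>
        rw [upperRight_mul hΦ (gen_mem g w i), map_add, map_smul, upperRight_mul hΦ (hmem i),
          upperRight_mul hΦ (gen_mem g w i), hsq, ih, neg_one_zpow_add]
        simp
      | zero => simp
      | add p a b _ _ iha ihb => rw [map_add, map_add, iha, ihb, add_zero]
      | smul p c a _ ih => rw [map_smul, map_smul, ih, smul_zero]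
    have h : upperRight Φ ∘ₗ upperRight Φ = 0 :=
      DirectSum.decompose_lhom_ext (wordGrading k g w) fun _ => LinearMap.ext fun a =>
        homogeneous a.2
    exact DFunLike.congr_fun h

end WordGrading

end LeibnizMatrix

namespace Env

variable {k : Type*} [Field k] {n : ℕ} {deg : Fin n → ℤ}
  (P : DGPoissonStructure (Poly.grading k deg))

theorem isConnection : IsConnection (m P) (y P) P := fun i j =>
  sub_eq_iff_eq_add'.mpr (y_mul_x i j)

theorem h_eq_hamiltonian : h P = hamiltonian (m P) (y P) := by
  ext f
  simp [h, FreeExt.psi_apply, hamiltonian_apply, m, y]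

theorem h_x (i : Fin n) : h P (Poly.x k deg i) = y P i := by
  rw [h_eq_hamiltonian, hamiltonian_x]

theorem h_mul {p q : ℤ} {a b : Poly k deg} (ha : a ∈ Poly.grading k deg p)
    (hb : b ∈ Poly.grading k deg q) :
    h P (a * b) = m P a * h P b + (-1 : k) ^ (p * q) • (m P b * h P a) := by
  rw [h_eq_hamiltonian, hamiltonian_mul _ _ ha hb]

theorem superCommutator_h_m {p q : ℤ} {a b : Poly k deg} (ha : a ∈ Poly.grading k deg p)
    (hb : b ∈ Poly.grading k deg q) :
    superCommutator k p q (h P a) (m P b) = m P (P.bracket a b) := by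
  rw [h_eq_hamiltonian, (isConnection P).superCommutator_hamiltonian_map ha hb]

theorem superCommutator_h_h {p q : ℤ} {a b : Poly k deg} (ha : a ∈ Poly.grading k deg p)
    (hb : b ∈ Poly.grading k deg q) :
    superCommutator k p q (h P a) (h P b) = h P (P.bracket a b) := by
  have hcurv : curvature (m P) (y P) P p q a b ∈ (⊥ : Ideal (Env P)) := by
    refine (isConnection P).curvature_mem ⊥ (fun i j => ?_) ha hb
    rw [Ideal.mem_bot, curvature_apply, hamiltonian_x, hamiltonian_x, ← h_eq_hamiltonian,
      superCommutator_apply, y_mul_y i j, add_sub_cancel_left, sub_self]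
  rwa [Ideal.mem_bot, curvature_apply, ← h_eq_hamiltonian, sub_eq_zero] at hcurv

variable {P} in
theorem h_mem {p : ℤ} {f : Poly k deg} (hf : f ∈ Poly.grading k deg p) :
    h P f ∈ grading P p := by
  rw [h_eq_hamiltonian, hamiltonian_apply]
  refine Submodule.sum_mem _ fun r _ => ?_
  have hr := SetLike.mul_mem_graded (m_mem (P := P) (Poly.psiMatrix_of_mem r hf).2.2)
    (y_mem (P := P) r)
  rwa [sub_add_cancel] at hr

/-- The lift to `F(R)` of the algebra map `leibnizHom`. -/
def leibnizHomFree : FreeExt k deg →ₐ[k] Matrix (Fin 2) (Fin 2) (Env P) :=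
  FreeExt.lift (fun i => leibnizMatrix k (deg i) (x P i) (m P (P.d (Poly.x k deg i))))
    (fun i => leibnizMatrix k (deg i) (y P i) (h P (P.d (Poly.x k deg i)))) fun i j => by
      have hx (i : Fin n) := Poly.x_mem (k := k) (deg := deg) i
      have hd (i : Fin n) := P.isDGAlgebra.map_mem _ _ (hx i)
      rw [← sub_eq_zero, ← superCommutator_apply, superCommutator_leibnizMatrix, x, x,
        Poly.superCommutator_map (m P) (hx i) (hx j), Poly.superCommutator_map (m P) (hd i) (hx j),
        Poly.superCommutator_map (m P) (hx i) (hd j), smul_zero, add_zero, leibnizMatrix_zero]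

theorem leibnizHomFree_y (i : Fin n) : leibnizHomFree P (FreeExt.y k deg i) =
    leibnizMatrix k (deg i) (y P i) (h P (P.d (Poly.x k deg i))) := by
  rw [leibnizHomFree, FreeExt.lift_y]

theorem leibnizHomFree_x (i : Fin n) : leibnizHomFree P (FreeExt.x k deg i) =
    leibnizMatrix k (deg i) (x P i) (m P (P.d (Poly.x k deg i))) := by
  rw [leibnizHomFree, FreeExt.lift_x]

theorem leibnizHomFree_incl {p : ℤ} {f : Poly k deg} (hf : f ∈ Poly.grading k deg p) :
    leibnizHomFree P (FreeExt.incl f) = leibnizMatrix k p (m P f) (m P (P.d f)) := by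
  induction hf using wordGrading_induction with
  | one => simp [P.d_one, leibnizMatrix_one]
  | gen_mul i p a _ ih =>
    rw [map_mul, map_mul, ih, FreeExt.incl, Poly.lift_x, leibnizHomFree_x, leibnizMatrix_mul,
      P.isDGAlgebra.leibniz _ _ (Poly.x_mem i)]
    simp only [map_mul, map_add, map_smul, x]
  | zero => simp [leibnizMatrix_zero]
  | add p a b _ _ iha ihb => simp only [map_add, iha, ihb, leibnizMatrix_add]
  | smul p c a _ ih => simp only [map_smul, ih, leibnizMatrix_smul]

theorem leibnizHomFree_psi {p : ℤ} {f : Poly k deg} (hf : f ∈ Poly.grading k deg p) :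
    leibnizHomFree P (FreeExt.psi f) = leibnizMatrix k p (h P f) (h P (P.d f)) := by
  have psi_eq : FreeExt.psi = hamiltonian (FreeExt.incl (k := k)) (FreeExt.y k deg) := rfl
  induction hf using wordGrading_induction with
  | one => simp [P.d_one, psi_eq, hamiltonian_one, h_eq_hamiltonian, leibnizMatrix_zero]
  | gen_mul i p a ha ih =>
    have hx := Poly.x_mem (k := k) (deg := deg) i
    have hd := P.isDGAlgebra.map_mem
    have hda : h P (P.d (Poly.x k deg i * a)) =
        m P (P.d (Poly.x k deg i)) * h P a + (-1 : k) ^ deg i • (m P (Poly.x k deg i) * h P (P.d a))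
          + (-1 : k) ^ (deg i * p) •
            (m P (P.d a) * y P i + (-1 : k) ^ p • (m P a * h P (P.d (Poly.x k deg i)))) := by
      rw [P.isDGAlgebra.leibniz _ _ hx, map_add, map_smul, h_mul P (hd _ _ hx) ha,
        h_mul P hx (hd _ _ ha), h_x]
      simp only [smul_add, smul_smul, mul_add, add_mul, mul_one, one_mul, neg_one_zpow_add]
      rw [mul_left_comm, Poly.sign_mul_self, mul_one]
      abel
    rw [hda, psi_eq, hamiltonian_mul _ _ hx ha, ← psi_eq, map_add, map_smul, map_mul, map_mul, ih,
      psi_eq, hamiltonian_x, leibnizHomFree_incl P hx, leibnizHomFree_incl P ha, leibnizHomFree_y,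
      leibnizMatrix_mul, leibnizMatrix_mul, leibnizMatrix_smul, add_comm p, leibnizMatrix_add,
      h_mul P hx ha, h_x]
  | zero => simp [leibnizMatrix_zero]
  | add p a b _ _ iha ihb => simp only [map_add, iha, ihb, leibnizMatrix_add]
  | smul p c a _ ih => simp only [map_smul, ih, leibnizMatrix_smul]

theorem leibnizHomFree_rel {a b : FreeExt k deg} (hab : EnvRel P a b) :
    leibnizHomFree P a = leibnizHomFree P b := by
  have hx (i : Fin n) := Poly.x_mem (k := k) (deg := deg) i
  have hd (i : Fin n) := P.isDGAlgebra.map_mem _ _ (hx i)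
  cases hab with
  | yy i j =>
    rw [← superCommutator_apply, map_sub, map_superCommutator, leibnizHomFree_y, leibnizHomFree_y,
      superCommutator_leibnizMatrix, ← h_x, ← h_x, superCommutator_h_h P (hx i) (hx j),
      superCommutator_h_h P (hd i) (hx j), superCommutator_h_h P (hx i) (hd j), ← map_smul,
      ← map_add, ← P.d_bracket _ _ _ (hx i) _ (hx j),
      leibnizHomFree_psi P (P.bracket_mem _ _ _ (hx i) _ (hx j)), sub_self, map_zero]
  | yx i j =>
    rw [← superCommutator_apply, map_sub, map_superCommutator, leibnizHomFree_y, leibnizHomFree_x,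
      superCommutator_leibnizMatrix, ← h_x, x, superCommutator_h_m P (hx i) (hx j),
      superCommutator_h_m P (hd i) (hx j), superCommutator_h_m P (hx i) (hd j), ← map_smul,
      ← map_add, ← P.d_bracket _ _ _ (hx i) _ (hx j),
      leibnizHomFree_incl P (P.bracket_mem _ _ _ (hx i) _ (hx j)), sub_self, map_zero]

/-- The algebra map `a ↦ !![(-1)^{|a|} a, δ(a); 0, a]`, which encodes the differential `δ` of
`R^e`. -/
def leibnizHom : Env P →ₐ[k] Matrix (Fin 2) (Fin 2) (Env P) :=
  RingQuot.liftAlgHom k ⟨leibnizHomFree P, fun _ _ hab => leibnizHomFree_rel P hab⟩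

theorem leibnizHom_mk (z : FreeExt k deg) : leibnizHom P (mk P z) = leibnizHomFree P z :=
  RingQuot.liftAlgHom_mkAlgHom_apply k _ _ _

/-- The differential of `R^e`. -/
def diff : Env P →ₗ[k] Env P := upperRight (leibnizHom P)

theorem diff_m (f : Poly k deg) : diff P (m P f) = m P (P.d f) := by
  have h : diff P ∘ₗ (m P).toLinearMap = (m P).toLinearMap ∘ₗ P.d :=
    DirectSum.decompose_lhom_ext (Poly.grading k deg) fun p => LinearMap.ext fun a =>
      upperRight_eq_of_eq_leibnizMatrix
        ((leibnizHom_mk P _).trans (leibnizHomFree_incl P a.2))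
  exact DFunLike.congr_fun h f

theorem diff_h (f : Poly k deg) : diff P (h P f) = h P (P.d f) := by
  have h : diff P ∘ₗ h P = h P ∘ₗ P.d :=
    DirectSum.decompose_lhom_ext (Poly.grading k deg) fun p => LinearMap.ext fun a =>
      upperRight_eq_of_eq_leibnizMatrix
        ((leibnizHom_mk P _).trans (leibnizHomFree_psi P a.2))
  exact DFunLike.congr_fun h f

theorem diff_x (i : Fin n) : diff P (x P i) = m P (P.d (Poly.x k deg i)) := diff_m P _

theorem diff_y (i : Fin n) : diff P (y P i) = h P (P.d (Poly.x k deg i)) := by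
  rw [← h_x, diff_h]

theorem isDGAlgebra : IsDGAlgebra (grading P) (diff P) := by
  have hd (i : Fin n) := P.isDGAlgebra.map_mem _ _ (Poly.x_mem (k := k) (deg := deg) i)
  refine isDGAlgebra_upperRight ?_ ?_ ?_ <;> rintro (i | i)
  · change leibnizHom P (x P i) = leibnizMatrix k (deg i) (x P i) (diff P (x P i))
    rw [← mk_x, leibnizHom_mk, leibnizHomFree_x, mk_x, diff_x]
  · change leibnizHom P (y P i) = leibnizMatrix k (deg i) (y P i) (diff P (y P i))
    rw [diff_y, y, leibnizHom_mk, leibnizHomFree_y, y]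
  · change diff P (x P i) ∈ _
    rw [diff_x]
    exact m_mem (hd i)
  · change diff P (y P i) ∈ _
    rw [diff_y]
    exact h_mem (hd i)
  · change diff P (diff P (x P i)) = 0
    rw [diff_x, diff_m, P.isDGAlgebra.sq_zero, map_zero]
  · change diff P (diff P (y P i)) = 0
    rw [diff_y, diff_h, P.isDGAlgebra.sq_zero, map_zero]

theorem isLeftDGModule :
    IsLeftDGModule (Poly.grading k deg) P.d (grading P) (diff P) where
  isInternal := DirectSum.Decomposition.isInternal _
  smul_mem _ _ _ ha _ hu := SetLike.mul_mem_graded (m_mem ha) hu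
  map_mem := (isDGAlgebra P).map_mem
  sq_zero := (isDGAlgebra P).sq_zero
  leibniz p a ha u := by
    rw [smul_def, smul_def, smul_def, (isDGAlgebra P).leibniz p _ (m_mem ha), diff_m]

theorem isRightDGModule :
    IsRightDGModule (Poly.grading k deg) P.d (grading P) (diff P) where
  isInternal := DirectSum.Decomposition.isInternal _
  smul_mem _ _ _ hu _ ha := SetLike.mul_mem_graded hu (m_mem ha)
  map_mem := (isDGAlgebra P).map_mem
  sq_zero := (isDGAlgebra P).sq_zero
  leibniz p u hu a := by
    rw [op_smul_def, op_smul_def, op_smul_def, (isDGAlgebra P).leibniz p _ hu, diff_m]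

end Env

section Fermionic

variable (k : Type*) [Field k] {n : ℕ} (deg : Fin n → ℤ)

/-- The generator `x_i` anticommutes with itself and is not allowed to be repeated in a standard
monomial: `|x_i|` is odd and the characteristic is not `2`. -/
def IsFermionic (i : Fin n) : Prop := Odd (deg i) ∧ (2 : k) ≠ 0

variable {k deg}

theorem IsFermionic.neg_one_zpow {i : Fin n} (hi : IsFermionic k deg i) :
    (-1 : k) ^ (deg i * deg i) = -1 := (hi.1.mul hi.1).neg_one_zpow

theorem neg_one_zpow_of_not_isFermionic {i : Fin n} (hi : ¬ IsFermionic k deg i) :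
    (-1 : k) ^ (deg i * deg i) = 1 := by
  by_cases hodd : Odd (deg i)
  · have h2 : (2 : k) = 0 := by
      by_contra h
      exact hi ⟨hodd, h⟩
    rw [(hodd.mul hodd).neg_one_zpow]
    linear_combination -h2
  · exact ((Int.not_odd_iff_even.1 hodd).mul_left _).neg_one_zpow

namespace DGPoissonStructure

variable (P : DGPoissonStructure (Poly.grading k deg))

/-- The conditions `{x_i, x_i} = 0` for non-fermionic `x_i` and `{x_i, {x_i, x_i}} = 0` for
fermionic `x_i`, which antisymmetry and the Jacobi identity force outside characteristic `2`
and `3`. -/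
structure IsAdmissible : Prop where
  bracket_self : ∀ i, ¬ IsFermionic k deg i → P.bracket (Poly.x k deg i) (Poly.x k deg i) = 0
  bracket_bracket_self : ∀ i, IsFermionic k deg i →
    P.bracket (Poly.x k deg i) (P.bracket (Poly.x k deg i) (Poly.x k deg i)) = 0

theorem isAdmissible (h2 : (2 : k) = 0 → ∀ i, P.bracket (Poly.x k deg i) (Poly.x k deg i) = 0)
    (h3 : (3 : k) = 0 → ∀ i, Odd (deg i) →
      P.bracket (Poly.x k deg i) (P.bracket (Poly.x k deg i) (Poly.x k deg i)) = 0) :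
    P.IsAdmissible where
  bracket_self i hi := by
    by_cases h : (2 : k) = 0
    · exact h2 h i
    have hanti := P.antisymm _ _ _ (Poly.x_mem i) _ (Poly.x_mem i)
    rw [neg_one_zpow_of_not_isFermionic hi, one_smul, eq_neg_iff_add_eq_zero, ← two_smul k]
      at hanti
    exact (smul_eq_zero.1 hanti).resolve_left h
  bracket_bracket_self i hi := by
    by_cases h : (3 : k) = 0
    · exact h3 h i hi.1
    have hx := Poly.x_mem (k := k) (deg := deg) i
    have hjacobi := P.jacobi _ _ _ _ hx _ hx _ hx
    rw [P.antisymm _ _ _ (P.bracket_mem _ _ _ hx _ hx) _ hx, add_mul, neg_one_zpow_add,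
      hi.neg_one_zpow] at hjacobi
    have hthree : (3 : k) • P.bracket (Poly.x k deg i)
        (P.bracket (Poly.x k deg i) (Poly.x k deg i)) = 0 := by
      linear_combination (norm := module) hjacobi
    exact (smul_eq_zero.1 hthree).resolve_left h

end DGPoissonStructure

end Fermionic

section StandardWords

variable (k : Type*) [Field k] {n : ℕ} (deg : Fin n → ℤ)

/-- `y_i` may stand somewhere to the left of `y_j` in a standard monomial. -/
def Precedes (i j : Fin n) : Prop := i < j ∨ i = j ∧ ¬ IsFermionic k deg i

/-- Standard words: increasing lists of indices in which fermionic ones are not repeated. They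
index the standard monomials in the `y_i`. -/
def StdWord : Type := {l : List (Fin n) // l.Pairwise (Precedes k deg)}

variable {k deg}

theorem Precedes.le {i j : Fin n} (h : Precedes k deg i j) : i ≤ j := by
  rcases h with h | ⟨h, -⟩
  exacts [h.le, h.le]

theorem Precedes.trans {i j l : Fin n} (hij : Precedes k deg i j) (hjl : Precedes k deg j l) :
    Precedes k deg i l := by
  rcases hij with hij | ⟨rfl, -⟩
  exacts [Or.inl (hij.trans_le hjl.le), hjl]

namespace StdWord

/-- The empty word. -/
def nil : StdWord k deg := ⟨[], List.Pairwise.nil⟩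

/-- Prepending `i` to the standard word `w` yields a standard word. -/
def CanCons (i : Fin n) (w : StdWord k deg) : Prop := ∀ j ∈ w.1, Precedes k deg i j

/-- The standard word obtained by prepending `i` to `w`. -/
def cons (i : Fin n) (w : StdWord k deg) (h : CanCons i w) : StdWord k deg :=
  ⟨i :: w.1, List.pairwise_cons.2 ⟨h, w.2⟩⟩

/-- The number of letters of a standard word, on which all inductions are based. -/
def length (w : StdWord k deg) : ℕ := w.1.length

theorem length_cons (i : Fin n) (w : StdWord k deg) (h : CanCons i w) :
    (cons i w h).length = w.length + 1 := rfl

theorem canCons_nil (i : Fin n) : CanCons i (nil : StdWord k deg) := by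
  simp [CanCons, nil]

theorem canCons_cons {i j : Fin n} {w : StdWord k deg} {h : CanCons j w} :
    CanCons i (cons j w h) ↔ Precedes k deg i j := by
  refine ⟨fun hi => hi j List.mem_cons_self, fun hij l hl => ?_⟩
  rcases List.mem_cons.1 hl with rfl | hl
  exacts [hij, hij.trans (h l hl)]

theorem CanCons.of_lt {i j : Fin n} {w : StdWord k deg} (hw : CanCons j w) (hij : i < j) :
    CanCons i w := fun l hl => Precedes.trans (Or.inl hij) (hw l hl)

@[elab_as_elim]
theorem induction {Q : StdWord k deg → Prop} (nil : Q nil)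
    (cons : ∀ j v h, Q v → Q (cons j v h)) (w : StdWord k deg) : Q w := by
  obtain ⟨l, hl⟩ := w
  induction l with
  | nil => exact nil
  | cons j l ih =>
    have hl' := List.pairwise_cons.1 hl
    exact cons j ⟨l, hl'.2⟩ hl'.1 (ih hl'.2)

theorem not_canCons_of_lt {i j : Fin n} {w : StdWord k deg} {h : CanCons j w} (hij : j < i) :
    ¬ CanCons i (cons j w h) := fun hi => (canCons_cons.1 hi).le.not_gt hij

theorem not_canCons_self {i : Fin n} {w : StdWord k deg} {h : CanCons i w}
    (hi : IsFermionic k deg i) : ¬ CanCons i (cons i w h) := fun hc => by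
  rcases canCons_cons.1 hc with h | ⟨-, h⟩
  exacts [h.false, h hi]

theorem lt_or_eq_of_not_canCons {i j : Fin n} {w : StdWord k deg} {h : CanCons j w}
    (hi : ¬ CanCons i (cons j w h)) : j < i ∨ i = j ∧ IsFermionic k deg i := by
  rw [canCons_cons] at hi
  rcases lt_trichotomy i j with hij | rfl | hij
  · exact absurd (Or.inl hij) hi
  · exact Or.inr ⟨rfl, by_contra fun h => hi (Or.inr ⟨rfl, h⟩)⟩
  · exact Or.inl hij

@[elab_as_elim]
theorem cons_cases {i : Fin n} {Q : StdWord k deg → Prop} (w : StdWord k deg)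
    (canCons : ∀ v, CanCons i v → Q v)
    (of_lt : ∀ j v (h : CanCons j v), j < i → Q (cons j v h))
    (self : ∀ v (h : CanCons i v), IsFermionic k deg i → Q (cons i v h)) : Q w := by
  by_cases hi : CanCons i w
  · exact canCons w hi
  induction w using StdWord.induction with
  | nil => exact absurd (canCons_nil i) hi
  | cons j v hj _ =>
    rcases lt_or_eq_of_not_canCons hi with hij | ⟨rfl, hfermionic⟩
    exacts [of_lt j v hj hij, self v hj hfermionic]

end StdWord

end StandardWords

section StdModule

open StdWord

/-- The free left `R`-module on the standard words, which will turn out to be `R^e`. -/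
abbrev StdModule (k : Type*) [Field k] {n : ℕ} (deg : Fin n → ℤ) : Type _ :=
  StdWord k deg →₀ Poly k deg

namespace StdModule

variable {k : Type*} [Field k] {n : ℕ} {deg : Fin n → ℤ}

/-- The basis element of the standard module belonging to a standard word. -/
def mono (w : StdWord k deg) : StdModule k deg := Finsupp.single w 1

theorem smul_mono (f : Poly k deg) (w : StdWord k deg) : f • mono w = Finsupp.single w f := by
  rw [mono, Finsupp.smul_single, smul_eq_mul, mul_one]

theorem mono_mem_supported {S : Set (StdWord k deg)} {w : StdWord k deg} (hw : w ∈ S) :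
    mono w ∈ Finsupp.supported (Poly k deg) (Poly k deg) S :=
  Finsupp.single_mem_supported _ _ hw

theorem supported_induction {S : Set (StdWord k deg)} {Q : StdModule k deg → Prop}
    (zero : Q 0) (add : ∀ u v, Q u → Q v → Q (u + v)) (smul : ∀ (f : Poly k deg) u, Q u → Q (f • u))
    (mono : ∀ w ∈ S, Q (mono w)) {u : StdModule k deg}
    (hu : u ∈ Finsupp.supported (Poly k deg) (Poly k deg) S) : Q u := by
  rw [Finsupp.supported_eq_span_single] at hu
  induction hu using Submodule.span_induction with
  | mem u h => obtain ⟨w, hw, rfl⟩ := h; exact mono w hw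
  | zero => exact zero
  | add u v _ _ hu hv => exact add u v hu hv
  | smul f u _ hu => exact smul f u hu

theorem mem_supported_univ (u : StdModule k deg) :
    u ∈ Finsupp.supported (Poly k deg) (Poly k deg) Set.univ := by
  simp

variable (k deg) in
/-- The action of `R` on the standard module. -/
def act : Poly k deg →ₐ[k] Module.End k (StdModule k deg) := Algebra.lsmul k k _

theorem act_apply (f : Poly k deg) (u : StdModule k deg) : act k deg f u = f • u := rfl

theorem hamiltonian_act_apply (Y : Fin n → Module.End k (StdModule k deg)) (f : Poly k deg)
    (u : StdModule k deg) :
    hamiltonian (act k deg) Y f u = ∑ r, Poly.psi r f • Y r u := by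
  simp [hamiltonian_apply, act_apply]

theorem hamiltonian_act_mem {Y : Fin n → Module.End k (StdModule k deg)} {u : StdModule k deg}
    {N : Submodule (Poly k deg) (StdModule k deg)} (h : ∀ r, Y r u ∈ N) (f : Poly k deg) :
    hamiltonian (act k deg) Y f u ∈ N := by
  rw [hamiltonian_act_apply]
  exact Submodule.sum_mem _ fun r _ => Submodule.smul_mem _ _ (h r)

theorem hamiltonian_act_congr {Y Y' : Fin n → Module.End k (StdModule k deg)}
    {u : StdModule k deg} (h : ∀ r, Y r u = Y' r u) (f : Poly k deg) :
    hamiltonian (act k deg) Y f u = hamiltonian (act k deg) Y' f u := by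
  simp only [hamiltonian_act_apply, h]

variable (P : DGPoissonStructure (Poly.grading k deg))

/-- The operator `T` satisfies the relation `T f = (-1)^{|x_i||f|} f T + {x_i, f}`, which `y_i`
satisfies in `R^e`. -/
def IsSkew (i : Fin n) (T : Module.End k (StdModule k deg)) : Prop :=
  ∀ (f : Poly k deg) (u : StdModule k deg),
    T (f • u) = Poly.twist i f • T u + P.bracket (Poly.x k deg i) f • u

theorem isConnection_of_isSkew {Y : Fin n → Module.End k (StdModule k deg)}
    (hY : ∀ i, IsSkew P i (Y i)) : IsConnection (act k deg) Y P := fun i j => by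
  refine LinearMap.ext fun u => ?_
  simp only [superCommutator_apply, LinearMap.sub_apply, LinearMap.smul_apply,
    Module.End.mul_apply, act_apply, hY i _ _, Poly.twist_of_mem i (Poly.x_mem j), smul_assoc,
    add_sub_cancel_left]

namespace IsSkew

variable {P} {i : Fin n} {T T' : Module.End k (StdModule k deg)}

theorem mem_supported (hT : IsSkew P i T) {S S' : Set (StdWord k deg)} (hSS' : S ⊆ S')
    (hS : ∀ w ∈ S, T (mono w) ∈ Finsupp.supported (Poly k deg) (Poly k deg) S')
    {u : StdModule k deg} (hu : u ∈ Finsupp.supported (Poly k deg) (Poly k deg) S) :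
    T u ∈ Finsupp.supported (Poly k deg) (Poly k deg) S' := by
  suffices h : u ∈ Finsupp.supported (Poly k deg) (Poly k deg) S' ∧
      T u ∈ Finsupp.supported (Poly k deg) (Poly k deg) S' from h.2
  refine supported_induction (Q := fun u => u ∈ Finsupp.supported (Poly k deg) (Poly k deg) S' ∧
    T u ∈ Finsupp.supported (Poly k deg) (Poly k deg) S') (by simp) (fun u v hu hv => ?_)
    (fun f u hu => ?_) (fun w hw => ⟨mono_mem_supported (hSS' hw), hS w hw⟩) hu
  · rw [map_add]
    exact ⟨Submodule.add_mem _ hu.1 hv.1, Submodule.add_mem _ hu.2 hv.2⟩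
  · rw [hT]
    exact ⟨Submodule.smul_mem _ _ hu.1,
      Submodule.add_mem _ (Submodule.smul_mem _ _ hu.2) (Submodule.smul_mem _ _ hu.1)⟩

theorem eq_of_mem_supported (hT : IsSkew P i T) (hT' : IsSkew P i T') {S : Set (StdWord k deg)}
    (hS : ∀ w ∈ S, T (mono w) = T' (mono w)) {u : StdModule k deg}
    (hu : u ∈ Finsupp.supported (Poly k deg) (Poly k deg) S) : T u = T' u := by
  refine supported_induction (Q := fun u => T u = T' u) ?_ (fun u v hu hv => ?_)
    (fun f u hu => ?_) hS hu
  · rw [map_zero, map_zero]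
  · rw [map_add, map_add, hu, hv]
  · rw [hT, hT', hu]

end IsSkew

/-- The operator with values `b w` on the basis that satisfies `IsSkew P i`. -/
def skew (i : Fin n) (b : StdWord k deg → StdModule k deg) : Module.End k (StdModule k deg) :=
  Finsupp.lsum k fun w =>
    (LinearMap.toSpanSingleton (Poly k deg) (StdModule k deg) (b w)).restrictScalars k ∘ₗ
      (Poly.twist i).toLinearMap + Finsupp.lsingle w ∘ₗ P.bracket (Poly.x k deg i)

theorem skew_single (i : Fin n) (b : StdWord k deg → StdModule k deg) (w : StdWord k deg)
    (f : Poly k deg) : skew P i b (Finsupp.single w f) =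
      Poly.twist i f • b w + Finsupp.single w (P.bracket (Poly.x k deg i) f) := by
  simp [skew]

theorem skew_mono (i : Fin n) (b : StdWord k deg → StdModule k deg) (w : StdWord k deg) :
    skew P i b (mono w) = b w := by
  simp [mono, skew_single, P.bracket_one (Poly.x_mem i)]

theorem isSkew_skew (i : Fin n) (b : StdWord k deg → StdModule k deg) :
    IsSkew P i (skew P i b) := fun f u => by
  induction u using Finsupp.induction_linear with
  | zero => simp
  | add u v hu hv => simp only [smul_add, map_add, hu, hv]; abel
  | single w g =>
    rw [Finsupp.smul_single, skew_single, skew_single, smul_eq_mul, map_mul, P.bracket_x_mul,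
      Finsupp.single_add, smul_add, Finsupp.smul_single, Finsupp.smul_single, mul_smul,
      smul_eq_mul, smul_eq_mul]
    abel

end StdModule

end StdModule

section YOperators

open StdWord

namespace StdModule

variable {k : Type*} [Field k] {n : ℕ} {deg : Fin n → ℤ}

/-- The words that may occur in `y_i w`. The condition on those of length `w.length + 1` is there
to make `y_j y_i w` computable when `j < i` and `j w` is standard. -/
def growth (i : Fin n) (w : StdWord k deg) : Set (StdWord k deg) :=
  {v | v.length ≤ w.length ∨
    v.length = w.length + 1 ∧ ∀ j, j < i → CanCons j w → CanCons j v}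

theorem growth_subset (i : Fin n) (w : StdWord k deg) :
    growth i w ⊆ {v | v.length ≤ w.length + 1} := by
  rintro v (h | ⟨h, -⟩)
  exacts [h.trans (Nat.le_succ _), h.le]

theorem cons_mem_growth {i : Fin n} {w : StdWord k deg} (h : CanCons i w) :
    cons i w h ∈ growth i w :=
  Or.inr ⟨length_cons i w h, fun _ hj _ => canCons_cons.2 (Or.inl hj)⟩

variable (P : DGPoissonStructure (Poly.grading k deg))

/-- Operators on the standard module which resemble the action of the `y_i`: they have the right
commutation relations with `R`, the right values on standard words that remain standard, and values
of the right size on the others. -/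
structure IsStandard (Y : Fin n → Module.End k (StdModule k deg)) : Prop where
  isSkew : ∀ i, IsSkew P i (Y i)
  mono_of_canCons : ∀ {i w} (h : CanCons i w), Y i (mono w) = mono (cons i w h)
  mono_mem : ∀ i w, Y i (mono w) ∈ Finsupp.supported (Poly k deg) (Poly k deg) (growth i w)

open Classical in
/-- The value of `y_i` on a basis element, computed from approximations `Y` to the operators
`y_r` by means of the relations of `R^e`. -/
def step (Y : Fin n → Module.End k (StdModule k deg)) (i : Fin n) (w : StdWord k deg) :
    StdModule k deg :=
  if h : CanCons i w then mono (cons i w h) else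
    match w with
    | ⟨[], _⟩ => 0
    | ⟨j :: l, hw⟩ =>
      if i = j then
        (2⁻¹ : k) • hamiltonian (act k deg) Y (P.bracket (Poly.x k deg i) (Poly.x k deg i))
          (mono ⟨l, (List.pairwise_cons.1 hw).2⟩)
      else
        (-1 : k) ^ (deg i * deg j) • Y j (Y i (mono ⟨l, (List.pairwise_cons.1 hw).2⟩)) +
          hamiltonian (act k deg) Y (P.bracket (Poly.x k deg i) (Poly.x k deg j))
            (mono ⟨l, (List.pairwise_cons.1 hw).2⟩)

section Step

variable {P} {Y Y' : Fin n → Module.End k (StdModule k deg)} {i j : Fin n} {w : StdWord k deg}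

theorem step_of_canCons (h : CanCons i w) : step P Y i w = mono (cons i w h) := by
  rw [step, dif_pos h]

theorem step_cons_self (h : CanCons i w) (hi : IsFermionic k deg i) :
    step P Y i (cons i w h) = (2⁻¹ : k) • hamiltonian (act k deg) Y
      (P.bracket (Poly.x k deg i) (Poly.x k deg i)) (mono w) := by
  rw [step, dif_neg (not_canCons_self hi)]
  exact if_pos rfl

theorem step_cons_of_lt (h : CanCons j w) (hij : j < i) :
    step P Y i (cons j w h) = (-1 : k) ^ (deg i * deg j) • Y j (Y i (mono w)) +
      hamiltonian (act k deg) Y (P.bracket (Poly.x k deg i) (Poly.x k deg j)) (mono w) := by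
  rw [step, dif_neg (not_canCons_of_lt hij)]
  exact if_neg hij.ne'

theorem IsStandard.mem_of_length (hY : IsStandard P Y) (i : Fin n) {q : ℕ} {u : StdModule k deg}
    (hu : u ∈ Finsupp.supported (Poly k deg) (Poly k deg) {v | v.length < q}) :
    Y i u ∈ Finsupp.supported (Poly k deg) (Poly k deg) {v | v.length < q + 1} :=
  (hY.isSkew i).mem_supported (fun _ hv => Nat.lt_succ_of_lt hv)
    (fun w hw => Finsupp.supported_mono ((growth_subset i w).trans fun _ hv =>
      Nat.lt_succ_of_le (le_trans hv hw)) (hY.mono_mem i w)) hu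

theorem IsStandard.step_mem (hY : IsStandard P Y) (i : Fin n) (w : StdWord k deg) :
    step P Y i w ∈ Finsupp.supported (Poly k deg) (Poly k deg) (growth i w) := by
  have hamiltonian_mem (f : Poly k deg) (j : Fin n) (v : StdWord k deg) (h : CanCons j v) :
      hamiltonian (act k deg) Y f (mono v) ∈
        Finsupp.supported (Poly k deg) (Poly k deg) (growth i (cons j v h)) :=
    hamiltonian_act_mem (fun r => Finsupp.supported_mono
      ((growth_subset r v).trans fun _ hv => Or.inl hv) (hY.mono_mem r v)) f
  induction w using StdWord.cons_cases (i := i) with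
  | canCons v h =>
    rw [step_of_canCons h]
    exact mono_mem_supported (cons_mem_growth h)
  | of_lt j v h hij =>
    rw [step_cons_of_lt h hij]
    refine Submodule.add_mem _ (Submodule.smul_of_tower_mem _ _ ?_) (hamiltonian_mem _ j v h)
    refine (hY.isSkew j).mem_supported (fun u hu => Or.inl (growth_subset i v hu)) ?_
      (hY.mono_mem i v)
    rintro u (hu | ⟨hu, hcons⟩)
    · exact Finsupp.supported_mono (fun t ht => Or.inl
        ((growth_subset j u ht).trans (Nat.succ_le_succ hu))) (hY.mono_mem j u)
    · rw [hY.mono_of_canCons (hcons j hij h)]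
      refine mono_mem_supported (Or.inr ⟨by rw [length_cons, length_cons, hu], fun l _ hl => ?_⟩)
      exact canCons_cons.2 (canCons_cons.1 hl)
  | self v h hi =>
    rw [step_cons_self h hi]
    exact Submodule.smul_of_tower_mem _ _ (hamiltonian_mem _ i v h)

theorem IsStandard.step_congr (hY : IsStandard P Y) (hY' : IsStandard P Y')
    (heq : ∀ j v, v.length < w.length → Y j (mono v) = Y' j (mono v)) :
    step P Y i w = step P Y' i w := by
  induction w using StdWord.cons_cases (i := i) with
  | canCons v h => rw [step_of_canCons h, step_of_canCons h]
  | of_lt j v h hij =>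
    have hv (r : Fin n) : Y r (mono v) = Y' r (mono v) := heq r v (Nat.lt_succ_self _)
    have hgrowth : Y j (Y i (mono v)) = Y' j (Y i (mono v)) := by
      refine (hY.isSkew j).eq_of_mem_supported (hY'.isSkew j) ?_ (hY.mono_mem i v)
      rintro u (hu | ⟨-, hcons⟩)
      · exact heq j u (Nat.lt_succ_of_le hu)
      · rw [hY.mono_of_canCons (hcons j hij h), hY'.mono_of_canCons (hcons j hij h)]
    rw [step_cons_of_lt h hij, step_cons_of_lt h hij, hgrowth, hv i, hamiltonian_act_congr hv]
  | self v h hi =>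
    rw [step_cons_self h hi, step_cons_self h hi,
      hamiltonian_act_congr fun r => heq r v (Nat.lt_succ_self _)]

end Step

open Classical in
/-- Successive approximations to the operators `y_i` on the standard module; the `q`-th one is
correct on words of length less than `q`. -/
def approx : ℕ → Fin n → Module.End k (StdModule k deg)
  | 0, i => skew P i fun w => if h : CanCons i w then mono (cons i w h) else 0
  | q + 1, i => skew P i (step P (approx q) i)

/-- The operators by which the generators `y_i` of `R^e` act on the standard module. -/
def yAct (i : Fin n) : Module.End k (StdModule k deg) :=
  skew P i fun w => step P (approx P w.length) i w

variable {P}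

theorem isStandard_approx (q : ℕ) : IsStandard P (approx P q) := by
  induction q with
  | zero =>
    refine ⟨fun i => isSkew_skew P i _, fun h => by rw [approx, skew_mono, dif_pos h],
      fun i w => ?_⟩
    rw [approx, skew_mono]
    split_ifs with h
    exacts [mono_mem_supported (cons_mem_growth h), Submodule.zero_mem _]
  | succ q ih =>
    refine ⟨fun i => isSkew_skew P i _, fun h => by rw [approx, skew_mono, step_of_canCons h],
      fun i w => ?_⟩
    rw [approx, skew_mono]
    exact ih.step_mem i w

theorem approx_succ_mono (q : ℕ) (i : Fin n) (w : StdWord k deg) (hw : w.length < q) :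
    approx P (q + 1) i (mono w) = approx P q i (mono w) := by
  induction q generalizing i w with
  | zero => exact absurd hw (Nat.not_lt_zero _)
  | succ q ih =>
    rw [approx, skew_mono, approx, skew_mono]
    exact (isStandard_approx _).step_congr (isStandard_approx _) fun j v hv =>
      ih j v (hv.trans_le (Nat.le_of_lt_succ hw))

theorem yAct_mono_eq_approx {q : ℕ} (i : Fin n) {w : StdWord k deg} (hw : w.length < q) :
    yAct P i (mono w) = approx P q i (mono w) := by
  induction q, Nat.succ_le_of_lt hw using Nat.le_induction with
  | base => rw [yAct, skew_mono, approx, skew_mono]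
  | succ q hq ih => rw [approx_succ_mono q i w hq, ih hq]

variable (P) in
theorem isStandard_yAct : IsStandard P (yAct P) where
  isSkew i := isSkew_skew P i _
  mono_of_canCons h := by rw [yAct, skew_mono, step_of_canCons h]
  mono_mem i w := by
    rw [yAct, skew_mono]
    exact (isStandard_approx _).step_mem i w

theorem yAct_mono (i : Fin n) (w : StdWord k deg) : yAct P i (mono w) = step P (yAct P) i w := by
  rw [yAct, skew_mono]
  exact (isStandard_approx _).step_congr (isStandard_yAct P) fun j v hv =>
    (yAct_mono_eq_approx j hv).symm

variable (P) in
theorem isConnection_yAct : IsConnection (act k deg) (yAct P) P :=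
  isConnection_of_isSkew P (isStandard_yAct P).isSkew

end StdModule

end YOperators

section Flatness

variable {k : Type*} [Field k] {n : ℕ} {deg : Fin n → ℤ}
  {P : DGPoissonStructure (Poly.grading k deg)}

namespace StdModule

open StdWord

variable (P) in
/-- The defect of the relation between `y_i` and `y_j` on the standard module. -/
abbrev curv (i j : Fin n) : Module.End k (StdModule k deg) :=
  curvature (act k deg) (yAct P) P (deg i) (deg j) (Poly.x k deg i) (Poly.x k deg j)

theorem curv_apply (i j : Fin n) (u : StdModule k deg) :
    curv P i j u = yAct P i (yAct P j u) - (-1 : k) ^ (deg i * deg j) •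
      yAct P j (yAct P i u) - hamiltonian (act k deg) (yAct P)
        (P.bracket (Poly.x k deg i) (Poly.x k deg j)) u := by
  simp [curv, curvature_apply, superCommutator_apply, hamiltonian_x]

theorem curv_eq_zero_comm {i j : Fin n} {u : StdModule k deg} :
    curv P i j u = 0 ↔ curv P j i u = 0 := by
  have swap {i j : Fin n} (h : curv P i j u = 0) : curv P j i u = 0 := by
    rw [curv, curvature_swap _ _ P (Poly.x_mem j) (Poly.x_mem i), LinearMap.neg_apply,
      LinearMap.smul_apply, h, smul_zero, neg_zero]
  exact ⟨swap, swap⟩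

theorem curv_smul_eq_zero {i j : Fin n} {u : StdModule k deg} (h : curv P i j u = 0)
    (f : Poly k deg) : curv P i j (f • u) = 0 := by
  induction f using DirectSum.Decomposition.inductionOn (Poly.grading k deg) with
  | zero => simp
  | homogeneous f =>
    have hcomm := (isConnection_yAct P).superCommutator_curvature_map (Poly.x_mem i) (Poly.x_mem j)
      f.2
    rw [superCommutator_apply, sub_eq_zero] at hcomm
    have hcomm_u := DFunLike.congr_fun hcomm u
    rwa [Module.End.mul_apply, LinearMap.smul_apply, Module.End.mul_apply, h, map_zero,
      smul_zero] at hcomm_u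
  | add f g hf hg => rw [add_smul, map_add, hf, hg, add_zero]

theorem curv_eq_zero_of_mem_supported {i j : Fin n} {S : Set (StdWord k deg)}
    (h : ∀ w ∈ S, curv P i j (mono w) = 0) {u : StdModule k deg}
    (hu : u ∈ Finsupp.supported (Poly k deg) (Poly k deg) S) : curv P i j u = 0 :=
  supported_induction (Q := fun u => curv P i j u = 0) (map_zero _)
    (fun u v hu hv => by rw [map_add, hu, hv, add_zero])
    (fun f u hu => curv_smul_eq_zero hu f) h hu

variable (P) in
/-- The relations of `R^e` between the `y_i` hold on the vector `u`. -/
def IsFlat (u : StdModule k deg) : Prop := ∀ i j, curv P i j u = 0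

namespace IsFlat

variable {u : StdModule k deg}

theorem curvature_apply_eq_zero (hu : IsFlat P u) {p q : ℤ} {a b : Poly k deg}
    (ha : a ∈ Poly.grading k deg p) (hb : b ∈ Poly.grading k deg q) :
    curvature (act k deg) (yAct P) P p q a b u = 0 :=
  (isConnection_yAct P).curvature_mem (Ideal.torsionOf _ _ u) hu ha hb

theorem curv_yAct_cyclic (hu : IsFlat P u) (i j l : Fin n) :
    curv P i j (yAct P l u) - (-1 : k) ^ (deg j * deg l) • curv P i l (yAct P j u) +
      (-1 : k) ^ (deg i * (deg j + deg l)) • curv P j l (yAct P i u) = 0 := by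
  have hmem := curvature_mul_hamiltonian_mem (act k deg) (yAct P) P
    (I := Ideal.torsionOf (Module.End k (StdModule k deg)) _ u) (hu.curvature_apply_eq_zero · ·)
    (Poly.x_mem i) (Poly.x_mem j) (Poly.x_mem l)
  rwa [hamiltonian_x, hamiltonian_x, hamiltonian_x] at hmem

theorem curv_yAct (hu : IsFlat P u) {i j l : Fin n} (hil : curv P i l (yAct P j u) = 0)
    (hjl : curv P j l (yAct P i u) = 0) : curv P i j (yAct P l u) = 0 := by
  simpa only [hil, hjl, smul_zero, sub_zero, add_zero] using hu.curv_yAct_cyclic i j l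

theorem curv_yAct_of_isFermionic (hu : IsFlat P u) {i j : Fin n} (hi : IsFermionic k deg i)
    (h : curv P i i (yAct P j u) = 0) : curv P j i (yAct P i u) = 0 := by
  have htwice := hu.curv_yAct_cyclic j i i
  rw [h, smul_zero, add_zero, hi.neg_one_zpow, neg_one_smul, sub_neg_eq_add, ← two_smul k]
    at htwice
  exact (smul_eq_zero.1 htwice).resolve_left hi.2

theorem curv_yAct_self (hu : IsFlat P u) {i : Fin n} (hi : IsFermionic k deg i)
    (h : P.bracket (Poly.x k deg i) (P.bracket (Poly.x k deg i) (Poly.x k deg i)) = 0) :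
    curv P i i (yAct P i u) = 0 := by
  have hx : Poly.x k deg i ∈ _ := Poly.x_mem i
  have hsquare := congrArg (yAct P i) (hu i i)
  have hbracket := hu.curvature_apply_eq_zero hx (P.bracket_mem _ _ _ hx _ hx)
  rw [curvature_apply, LinearMap.sub_apply, h, map_zero, LinearMap.zero_apply, sub_zero,
    superCommutator_apply, hamiltonian_x, mul_add, neg_one_zpow_add, hi.neg_one_zpow, neg_mul_neg,
    one_mul, one_smul, LinearMap.sub_apply, Module.End.mul_apply, Module.End.mul_apply] at hbracket
  rw [curv_apply, map_sub, map_sub, map_smul, map_zero, hi.neg_one_zpow] at hsquare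
  rw [curv_apply, hi.neg_one_zpow]
  linear_combination (norm := module) hsquare + hbracket

end IsFlat

theorem curv_mono_of_canCons (hP : P.IsAdmissible) (i : Fin n) {j : Fin n} {w : StdWord k deg}
    (hj : CanCons j w) : curv P i j (mono w) = 0 := by
  have of_lt {i j : Fin n} (hj : CanCons j w) (hji : j < i) : curv P i j (mono w) = 0 := by
    rw [curv_apply, (isStandard_yAct P).mono_of_canCons hj, yAct_mono i, step_cons_of_lt hj hji]
    abel
  rcases lt_trichotomy i j with hij | rfl | hji
  · exact curv_eq_zero_comm.1 (of_lt (hj.of_lt hij) hij)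
  · rw [curv_apply]
    by_cases hi : IsFermionic k deg i
    · rw [(isStandard_yAct P).mono_of_canCons hj, yAct_mono i, step_cons_self hj hi,
        hi.neg_one_zpow, neg_smul, one_smul, sub_neg_eq_add, ← add_smul, ← two_mul,
        mul_inv_cancel₀ hi.2, one_smul, sub_self]
    · rw [hP.bracket_self i hi, neg_one_zpow_of_not_isFermionic hi, one_smul, sub_self, map_zero,
        LinearMap.zero_apply, sub_zero]
  · exact of_lt hj hji

theorem isFlat_mono (hP : P.IsAdmissible) (w : StdWord k deg) : IsFlat P (mono w) := by
  induction hq : w.length using Nat.strong_induction_on generalizing w with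
  | _ q ih =>
    intro i j
    by_cases hj : CanCons j w
    · exact curv_mono_of_canCons hP i hj
    by_cases hi : CanCons i w
    · exact curv_eq_zero_comm.1 (curv_mono_of_canCons hP j hi)
    induction w using StdWord.induction with
    | nil => exact absurd (canCons_nil i) hi
    | cons l w hl _ =>
      rw [length_cons] at hq
      have hw : IsFlat P (mono w) := ih w.length (by lia) w rfl
      have curv_yAct_of_lt (r s : Fin n) (hs : l < s) : curv P r l (yAct P s (mono w)) = 0 := by
        refine curv_eq_zero_of_mem_supported ?_ ((isStandard_yAct P).mono_mem s w)
        rintro v (hv | ⟨-, hv⟩)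
        · exact ih v.length (by lia) v rfl r l
        · exact curv_mono_of_canCons hP r (hv l hs hl)
      rw [← (isStandard_yAct P).mono_of_canCons hl]
      rcases lt_or_eq_of_not_canCons hi with hi' | ⟨rfl, hi'⟩ <;>
      rcases lt_or_eq_of_not_canCons hj with hj' | ⟨rfl, hj'⟩
      · exact hw.curv_yAct (curv_yAct_of_lt i j hj') (curv_yAct_of_lt j i hi')
      · exact hw.curv_yAct_of_isFermionic hj' (curv_yAct_of_lt j i hi')
      · exact curv_eq_zero_comm.1
          (hw.curv_yAct_of_isFermionic hi' (curv_yAct_of_lt i j hj'))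
      · exact hw.curv_yAct_self hj' (hP.bracket_bracket_self _ hj')

theorem isFlat (hP : P.IsAdmissible) (u : StdModule k deg) : IsFlat P u := fun i j =>
  curv_eq_zero_of_mem_supported (fun w _ => isFlat_mono hP w i j) (mem_supported_univ u)

end StdModule

end Flatness

section Bases

section Triangular

variable {ι M N : Type*} [AddCommGroup M] [AddCommGroup N] {ℓ : ι → ℕ}
  {T : (ι →₀ M) →+ (ι →₀ N)} {τ : ι → M → N}

theorem injective_of_triangular (hτ : ∀ w, Function.Injective (τ w))
    (hT : ∀ w m v, ℓ w ≤ ℓ v → T (Finsupp.single w m) v = Finsupp.single w (τ w m) v) :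
    Function.Injective T := by
  have τ_zero (w : ι) : τ w 0 = 0 := by
    simpa using (hT w 0 w le_rfl).symm
  rw [injective_iff_map_eq_zero]
  intro c hc
  by_contra hne
  obtain ⟨w, hw, hmax⟩ := c.support.exists_max_image ℓ (Finsupp.support_nonempty_iff.2 hne)
  have hcw : T c w = τ w (c w) := by
    conv_lhs => rw [← Finsupp.sum_single c, Finsupp.sum, map_sum, Finsupp.finsetSum_apply]
    rw [Finset.sum_eq_single_of_mem w hw fun v hv hvw => by
      rw [hT v _ w (hmax v hv), Finsupp.single_eq_of_ne hvw.symm], hT w _ w le_rfl,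
      Finsupp.single_eq_same]
  rw [hc, Finsupp.zero_apply, ← τ_zero w] at hcw
  exact Finsupp.mem_support_iff.1 hw (hτ w hcw).symm

theorem surjective_of_triangular (hτ : ∀ w, Function.Surjective (τ w))
    (hT : ∀ w m v, ℓ w ≤ ℓ v → T (Finsupp.single w m) v = Finsupp.single w (τ w m) v) :
    Function.Surjective T := by
  have mem_of_single (u : ι →₀ N) (h : ∀ w ∈ u.support, Finsupp.single w (u w) ∈ T.range) :
      u ∈ T.range := by
    rw [← Finsupp.sum_single u]
    exact AddSubgroup.sum_mem _ h
  suffices single_mem : ∀ w a, Finsupp.single w a ∈ T.range from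
    fun u => mem_of_single u fun w _ => single_mem w (u w)
  intro w a
  induction hq : ℓ w using Nat.strong_induction_on generalizing w a with
  | _ q ih =>
    obtain ⟨m, rfl⟩ := hτ w a
    have hlower : T (Finsupp.single w m) - Finsupp.single w (τ w m) ∈ T.range := by
      refine mem_of_single _ fun v hv => ih (ℓ v) ?_ v _ rfl
      by_contra hle
      refine Finsupp.mem_support_iff.1 hv ?_
      rw [Finsupp.sub_apply, hT w m v (hq ▸ not_lt.1 hle), sub_self]
    simpa using T.range.sub_mem ⟨Finsupp.single w m, rfl⟩ hlower

theorem bijective_of_triangular (hτ : ∀ w, Function.Bijective (τ w))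
    (hT : ∀ w m v, ℓ w ≤ ℓ v → T (Finsupp.single w m) v = Finsupp.single w (τ w m) v) :
    Function.Bijective T :=
  ⟨injective_of_triangular (fun w => (hτ w).1) hT, surjective_of_triangular (fun w => (hτ w).2) hT⟩

end Triangular

theorem isBasis_iff_bijective {S : Type*} [Ring S] {M : Type*} [AddCommGroup M] [Module S M]
    {ι : Type*} {v : ι → M} :
    IsBasis S v ↔ Function.Bijective (Finsupp.linearCombination S v) := by
  rw [IsBasis, LinearIndependent, ← Finsupp.range_linearCombination, LinearMap.range_eq_top,
    Function.Bijective]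

variable {k : Type*} [Field k] {n : ℕ} {deg : Fin n → ℤ}

open StdModule StdWord MulOpposite

namespace StdWord

/-- The product of the `g i` along a standard word. -/
def eval {A : Type*} [Monoid A] (g : Fin n → A) (w : StdWord k deg) : A := (w.1.map g).prod

theorem eval_nil {A : Type*} [Monoid A] (g : Fin n → A) :
    (nil : StdWord k deg).eval g = 1 := rfl

theorem eval_cons {A : Type*} [Monoid A] (g : Fin n → A) {i : Fin n} {w : StdWord k deg}
    (h : CanCons i w) : (cons i w h).eval g = g i * w.eval g := rfl

end StdWord

theorem Poly.bijective_eval_twist (w : StdWord k deg) :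
    Function.Bijective fun f : Poly k deg => w.eval Poly.twist f := by
  induction w using StdWord.induction with
  | nil => exact Function.bijective_id
  | cons i w _ ih => exact (Poly.twist_involutive i).bijective.comp ih

namespace Env

section OfStd

variable (P : DGPoissonStructure (Poly.grading k deg))

theorem y_mul_m (i : Fin n) (f : Poly k deg) :
    y P i * m P f = m P (Poly.twist i f) * y P i + m P (P.bracket (Poly.x k deg i) f) := by
  induction f using DirectSum.Decomposition.inductionOn (Poly.grading k deg) with
  | zero => simp
  | homogeneous f =>
    rw [mul_eq_smul_mul_add_superCommutator k (deg i) _ (y P i),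
      (isConnection P).superCommutator_map i f.2, Poly.twist_of_mem i f.2, map_smul,
      smul_mul_assoc]
  | add f g hf hg => simp only [map_add, mul_add, add_mul, hf, hg]; abel

instance : IsScalarTower k (Poly k deg) (Env P) :=
  ⟨fun c f u => by rw [smul_def, smul_def, map_smul, smul_mul_assoc]⟩

instance : IsScalarTower k (Poly k deg)ᵐᵒᵖ (Env P) :=
  ⟨fun c f u => by
    obtain ⟨f, rfl⟩ := op_surjective f
    rw [← op_smul, op_smul_def, op_smul_def, map_smul, mul_smul_comm]⟩

/-- The `R`-linear map from the standard module to `R^e` sending a standard word to the product of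
the corresponding `y_i`. -/
def ofStd : StdModule k deg →ₗ[Poly k deg] Env P :=
  Finsupp.linearCombination (Poly k deg) fun w => w.eval (y P)

variable {P}

theorem ofStd_mono (w : StdWord k deg) : ofStd P (mono w) = w.eval (y P) := by
  simp [ofStd, mono]

theorem ofStd_mono_cons {i : Fin n} {w : StdWord k deg} (h : CanCons i w) :
    ofStd P (mono (cons i w h)) = y P i * ofStd P (mono w) := by
  rw [ofStd_mono, ofStd_mono, eval_cons]

theorem ofStd_smul (f : Poly k deg) (u : StdModule k deg) :
    ofStd P (f • u) = m P f * ofStd P u := map_smul _ _ _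

theorem ofStd_yAct_of_mem_supported {i : Fin n} {S : Set (StdWord k deg)}
    (h : ∀ w ∈ S, ofStd P (yAct P i (mono w)) = y P i * ofStd P (mono w)) {u : StdModule k deg}
    (hu : u ∈ Finsupp.supported (Poly k deg) (Poly k deg) S) :
    ofStd P (yAct P i u) = y P i * ofStd P u :=
  supported_induction (Q := fun u => ofStd P (yAct P i u) = y P i * ofStd P u) (by simp)
    (fun u v hu hv => by rw [map_add, map_add, map_add, hu, hv, mul_add])
    (fun f u hu => by
      rw [(isStandard_yAct P).isSkew, map_add, ofStd_smul, ofStd_smul, ofStd_smul, hu,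
        ← mul_assoc (y P i), y_mul_m, add_mul, mul_assoc]) h hu

theorem ofStd_hamiltonian {u : StdModule k deg}
    (h : ∀ i, ofStd P (yAct P i u) = y P i * ofStd P u) (f : Poly k deg) :
    ofStd P (hamiltonian (act k deg) (yAct P) f u) = Env.h P f * ofStd P u := by
  rw [hamiltonian_act_apply, map_sum, h_eq_hamiltonian, hamiltonian_apply, Finset.sum_mul]
  exact Finset.sum_congr rfl fun r _ => by rw [ofStd_smul, h, mul_assoc]

theorem ofStd_yAct_mono (i : Fin n) (w : StdWord k deg) :
    ofStd P (yAct P i (mono w)) = y P i * ofStd P (mono w) := by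
  induction hq : w.length using Nat.strong_induction_on generalizing i w with
  | _ q ih =>
    subst hq
    induction w using StdWord.cons_cases (i := i) with
    | canCons w h => rw [(isStandard_yAct P).mono_of_canCons h, ofStd_mono_cons]
    | of_lt j w h hij =>
      have hw (r : Fin n) := ih w.length (Nat.lt_succ_self _) r w rfl
      have hji : ofStd P (yAct P j (yAct P i (mono w))) = y P j * ofStd P (yAct P i (mono w)) := by
        refine ofStd_yAct_of_mem_supported ?_ ((isStandard_yAct P).mono_mem i w)
        rintro v (hv | ⟨-, hv⟩)
        · exact ih v.length (Nat.lt_succ_of_le hv) j v rfl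
        · rw [(isStandard_yAct P).mono_of_canCons (hv j hij h), ofStd_mono_cons]
      rw [yAct_mono, step_cons_of_lt h hij, map_add, LinearMap.map_smul_of_tower, hji, hw i,
        ofStd_hamiltonian hw, ofStd_mono_cons, ← mul_assoc, ← mul_assoc, y_mul_y i j, add_mul,
        smul_mul_assoc]
    | self w h hi =>
      have hw (r : Fin n) := ih w.length (Nat.lt_succ_self _) r w rfl
      have hsquare : y P i * y P i =
          (2⁻¹ : k) • Env.h P (P.bracket (Poly.x k deg i) (Poly.x k deg i)) := by
        have hcomm := y_mul_y (P := P) i i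
        rw [hi.neg_one_zpow, neg_one_smul, ← sub_eq_iff_eq_add', sub_neg_eq_add, ← two_smul k]
          at hcomm
        rw [← hcomm, inv_smul_smul₀ hi.2]
      rw [yAct_mono, step_cons_self h hi, LinearMap.map_smul_of_tower, ofStd_hamiltonian hw,
        ofStd_mono_cons, ← mul_assoc, hsquare, smul_mul_assoc]

theorem ofStd_yAct (i : Fin n) (u : StdModule k deg) :
    ofStd P (yAct P i u) = y P i * ofStd P u :=
  ofStd_yAct_of_mem_supported (fun w _ => ofStd_yAct_mono i w) (mem_supported_univ u)

end OfStd

section Action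

variable (P : DGPoissonStructure (Poly.grading k deg))

/-- The action of `F(R)` on the standard module. -/
def actFree : FreeExt k deg →ₐ[k] Module.End k (StdModule k deg) :=
  FreeExt.lift (fun i => act k deg (Poly.x k deg i)) (yAct P) fun i j => by
    rw [← map_mul, ← map_mul, ← map_smul, Poly.x_comm i j]

theorem actFree_x (i : Fin n) : actFree P (FreeExt.x k deg i) = act k deg (Poly.x k deg i) := by
  rw [actFree, FreeExt.lift_x]

theorem actFree_y (i : Fin n) : actFree P (FreeExt.y k deg i) = yAct P i := by
  rw [actFree, FreeExt.lift_y]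

theorem actFree_incl (f : Poly k deg) : actFree P (FreeExt.incl f) = act k deg f := by
  have hcomp : (actFree P).comp FreeExt.incl = act k deg := by
    refine Poly.hom_ext (B := Module.End k (StdModule k deg)) fun i => ?_
    rw [AlgHom.comp_apply, FreeExt.incl, Poly.lift_x, actFree_x]
  exact DFunLike.congr_fun hcomp f

theorem actFree_psi (f : Poly k deg) :
    actFree P (FreeExt.psi f) = hamiltonian (act k deg) (yAct P) f := by
  simp only [FreeExt.psi_apply, map_sum, map_mul, actFree_incl, actFree_y, hamiltonian_apply]

variable {P}

theorem actFree_rel (hP : P.IsAdmissible) {a b : FreeExt k deg} (hab : EnvRel P a b) :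
    actFree P a = actFree P b := by
  cases hab with
  | yy i j =>
    rw [map_sub, map_sub, map_smul, map_mul, map_mul, map_zero, actFree_psi, actFree_y, actFree_y]
    refine LinearMap.ext fun u => ?_
    have hflat := isFlat hP u i j
    rwa [curv_apply] at hflat
  | yx i j =>
    rw [map_sub, map_sub, map_smul, map_mul, map_mul, map_zero, actFree_incl, actFree_y, actFree_x,
      ← isConnection_yAct P i j, superCommutator_apply, sub_self]

variable (hP : P.IsAdmissible)

/-- The action of `R^e` on the standard module. -/
def actEnv : Env P →ₐ[k] Module.End k (StdModule k deg) :=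
  RingQuot.liftAlgHom k ⟨actFree P, fun _ _ hab => actFree_rel hP hab⟩

theorem actEnv_mk (z : FreeExt k deg) : actEnv hP (mk P z) = actFree P z :=
  RingQuot.liftAlgHom_mkAlgHom_apply k _ _ _

theorem actEnv_m (f : Poly k deg) : actEnv hP (m P f) = act k deg f := by
  rw [m, AlgHom.comp_apply, actEnv_mk, actFree_incl]

theorem actEnv_y (i : Fin n) : actEnv hP (y P i) = yAct P i := by
  rw [y, actEnv_mk, actFree_y]

theorem actEnv_eval (w : StdWord k deg) : actEnv hP (w.eval (y P)) (mono nil) = mono w := by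
  induction w using StdWord.induction with
  | nil => rw [eval_nil, map_one, Module.End.one_apply]
  | cons i w h ih =>
    rw [eval_cons, map_mul, Module.End.mul_apply, ih, actEnv_y,
      (isStandard_yAct P).mono_of_canCons h]

theorem actEnv_ofStd (u : StdModule k deg) : actEnv hP (ofStd P u) (mono nil) = u := by
  refine supported_induction (Q := fun u => actEnv hP (ofStd P u) (mono nil) = u) (by simp)
    (fun u v hu hv => ?_) (fun f u hu => ?_) (fun w _ => ?_) (mem_supported_univ u)
  · rw [map_add, map_add, LinearMap.add_apply, hu, hv]
  · rw [ofStd_smul, map_mul, Module.End.mul_apply, hu, actEnv_m, act_apply]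
  · rw [ofStd_mono, actEnv_eval]

theorem ofStd_actEnv (a : Env P) (u : StdModule k deg) :
    ofStd P (actEnv hP a u) = a * ofStd P u := by
  induction a using DirectSum.Decomposition.inductionOn (grading P) with
  | zero => simp
  | homogeneous a =>
    obtain ⟨a, ha⟩ := a
    induction ha using wordGrading_induction with
    | one => simp
    | gen_mul i p a _ ih =>
      rw [map_mul, Module.End.mul_apply, mul_assoc, ← ih]
      rcases i with i | i
      · rw [Sum.elim_inl, x, actEnv_m, act_apply, ofStd_smul]
      · rw [Sum.elim_inr, actEnv_y, ofStd_yAct]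
    | zero => simp
    | add p a b _ _ iha ihb => rw [map_add, LinearMap.add_apply, map_add, iha, ihb, add_mul]
    | smul p c a _ ih =>
      rw [map_smul, LinearMap.smul_apply, LinearMap.map_smul_of_tower, ih, smul_mul_assoc]
  | add a b iha ihb => rw [map_add, LinearMap.add_apply, map_add, iha, ihb, add_mul]

theorem ofStd_actEnv_mono_nil (a : Env P) : ofStd P (actEnv hP a (mono nil)) = a := by
  rw [ofStd_actEnv, ofStd_mono, eval_nil, mul_one]

theorem actEnv_eval_smul_sub_mem (w : StdWord k deg) (f : Poly k deg) :
    actEnv hP (w.eval (y P)) (f • mono nil) - w.eval Poly.twist f • mono w ∈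
      Finsupp.supported (Poly k deg) (Poly k deg) {v | v.length < w.length} := by
  induction w using StdWord.induction with
  | nil => simp [eval_nil]
  | cons i w h ih =>
    have hmem := Submodule.add_mem _ ((isStandard_yAct P).mem_of_length i ih)
      (Submodule.smul_mem _ (P.bracket (Poly.x k deg i) (w.eval Poly.twist f))
        (mono_mem_supported (S := {v | v.length < w.length + 1}) (Nat.lt_succ_self w.length)))
    rw [map_sub, (isStandard_yAct P).isSkew, (isStandard_yAct P).mono_of_canCons h, ← sub_sub,
      sub_add_cancel] at hmem
    rwa [eval_cons, eval_cons, map_mul, Module.End.mul_apply, actEnv_y]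

end Action

variable {P : DGPoissonStructure (Poly.grading k deg)}

theorem isBasis_eval (hP : P.IsAdmissible) :
    IsBasis (Poly k deg) fun w : StdWord k deg => w.eval (y P) :=
  isBasis_iff_bijective.2 (Function.bijective_iff_has_inverse.2
    ⟨fun a => actEnv hP a (mono nil), actEnv_ofStd hP, ofStd_actEnv_mono_nil hP⟩)

theorem isBasis_op_eval (hP : P.IsAdmissible) :
    IsBasis (Poly k deg)ᵐᵒᵖ fun w : StdWord k deg => w.eval (y P) := by
  have hact : Function.Bijective fun a : Env P => actEnv hP a (mono nil) :=
    Function.bijective_iff_has_inverse.2 ⟨ofStd P, ofStd_actEnv_mono_nil hP, actEnv_ofStd hP⟩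
  let T : (StdWord k deg →₀ (Poly k deg)ᵐᵒᵖ) →+ StdModule k deg :=
    ((LinearMap.applyₗ (mono nil)).comp (actEnv hP).toLinearMap).toAddMonoidHom.comp
      (Finsupp.linearCombination _ fun w => w.eval (y P)).toAddMonoidHom
  have hT : Function.Bijective T := by
    refine bijective_of_triangular (ℓ := length) (τ := fun w f => w.eval Poly.twist f.unop)
      (fun w => (Poly.bijective_eval_twist w).comp unop_bijective) fun w f v hv => ?_
    have hlower := (Finsupp.mem_supported' _ _).1 (actEnv_eval_smul_sub_mem hP w f.unop) v
      (not_lt.2 hv)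
    rw [Finsupp.sub_apply, sub_eq_zero, smul_mono _ w] at hlower
    rw [← hlower]
    change actEnv hP (Finsupp.linearCombination _ _ (Finsupp.single w f)) (mono nil) v = _
    rw [Finsupp.linearCombination_single, ← op_unop f, op_smul_def, map_mul, Module.End.mul_apply,
      actEnv_m, act_apply, unop_op]
  exact isBasis_iff_bijective.2 (hact.of_comp_iff' _ |>.1 hT)

end Env

end Bases

section IsBasis

variable {S : Type*} [Ring S] {M : Type*} [AddCommGroup M] [Module S M] {ι κ : Type*}

theorem IsBasis.comp_bijective {v : ι → M} (hv : IsBasis S v) {e : κ → ι}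
    (he : Function.Bijective e) : IsBasis S fun i => v (e i) :=
  ⟨hv.1.comp e he.injective, (congrArg _ (he.surjective.range_comp v)).trans hv.2⟩

theorem IsBasis.map_linearEquiv {N : Type*} [AddCommGroup N] [Module S N] {v : ι → M}
    (hv : IsBasis S v) (e : M ≃ₗ[S] N) : IsBasis S fun i => e (v i) := by
  refine ⟨hv.1.map' e.toLinearMap e.ker, ?_⟩
  have hrange : Set.range (fun i => e (v i)) = e.toLinearMap '' Set.range v := Set.range_comp e v
  rw [hrange, Submodule.span_image, hv.2, Submodule.map_top, LinearEquiv.range]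

open scoped Pointwise in
theorem IsBasis.smul {k : Type*} [Ring k] [Module k S] [Module k M] [IsScalarTower k S M]
    {b : ι → S} {c : κ → M} (hb : IsBasis k b) (hc : IsBasis S c) :
    IsBasis k fun p : ι × κ => b p.1 • c p.2 := by
  refine ⟨linearIndependent_smul hb.1 hc.1, ?_⟩
  have hrange : Set.range (fun p : ι × κ => b p.1 • c p.2) = Set.range b • Set.range c := by
    ext a
    simp [Set.mem_smul]
  rw [hrange, Submodule.span_smul_of_span_eq_top hb.2, hc.2, Submodule.restrictScalars_top]

end IsBasis

section OrderedMonomials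

variable {n : ℕ}

/-- The weakly increasing list of indices in which `r` occurs `J r` times: the word spelling the
ordered monomial with exponent `J`. -/
def exponentList (J : Fin n → ℕ) : List (Fin n) :=
  (List.ofFn fun r => List.replicate (J r) r).flatten

theorem count_exponentList (J : Fin n → ℕ) (r : Fin n) : (exponentList J).count r = J r := by
  simp [exponentList, List.count_flatten, List.map_ofFn, Function.comp_def, List.sum_ofFn,
    List.count_replicate]

theorem orderedMonomial_eq_prod_exponentList {A : Type*} [Ring A] (g : Fin n → A)
    (J : Fin n → ℕ) : orderedMonomial g J = ((exponentList J).map g).prod := by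
  simp [orderedMonomial, exponentList, List.prod_flatten, List.map_flatten, List.map_ofFn,
    Function.comp_def]

theorem map_orderedMonomial {A B F : Type*} [Ring A] [Ring B] [FunLike F A B]
    [MonoidHomClass F A B] (φ : F) (g : Fin n → A) (J : Fin n → ℕ) :
    φ (orderedMonomial g J) = orderedMonomial (fun r => φ (g r)) J := by
  simp [orderedMonomial, map_list_prod, List.map_ofFn, Function.comp_def]

theorem orderedMonomial_mem {k A : Type*} [CommRing k] [Ring A] [Algebra k A]
    {𝒜 : ℤ → Submodule k A} [SetLike.GradedMonoid 𝒜] {g : Fin n → A} {p : Fin n → ℤ}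
    (hg : ∀ r, g r ∈ 𝒜 (p r)) (J : Fin n → ℕ) :
    orderedMonomial g J ∈ 𝒜 (∑ r, (J r : ℤ) * p r) := by
  rw [← List.sum_ofFn]
  refine SetLike.list_prod_ofFn_mem_graded _ _ fun r => ?_
  simpa using SetLike.pow_mem_graded (J r) (hg r)

end OrderedMonomials

namespace Exponent

variable {k : Type*} [Field k] {n : ℕ} {deg : Fin n → ℤ}

/-- The standard word spelling the ordered monomial with exponent `J`. -/
def toWord (J : Exponent k deg) : StdWord k deg :=
  ⟨exponentList J.1, by
    rw [exponentList, List.pairwise_flatten, List.pairwise_ofFn]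
    refine ⟨fun l hl => ?_, fun i j hij a ha b hb => ?_⟩
    · obtain ⟨r, rfl⟩ := List.mem_ofFn.1 hl
      rw [List.pairwise_replicate]
      by_cases hr : IsFermionic k deg r
      · exact Or.inl (J.2 r hr.1 hr.2)
      · exact Or.inr (Or.inr ⟨rfl, hr⟩)
    · rw [List.eq_of_mem_replicate ha, List.eq_of_mem_replicate hb]
      exact Or.inl hij⟩

theorem count_toWord (J : Exponent k deg) (r : Fin n) : J.toWord.1.count r = J.1 r :=
  count_exponentList J.1 r

theorem orderedMonomial_eq_eval_toWord {A : Type*} [Ring A] (g : Fin n → A)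
    (J : Exponent k deg) : orderedMonomial g J.1 = J.toWord.eval g :=
  orderedMonomial_eq_prod_exponentList g J.1

theorem toWord_injective : Function.Injective (toWord (k := k) (deg := deg)) := fun J J' h =>
  Subtype.ext (funext fun r => by rw [← count_toWord, ← count_toWord, h])

end Exponent

section StdWordCount

variable {k : Type*} [Field k] {n : ℕ} {deg : Fin n → ℤ}

theorem StdWord.count_le_one (w : StdWord k deg) {r : Fin n} (hr : IsFermionic k deg r) :
    w.1.count r ≤ 1 := by
  by_contra hcount
  have hpair : [r, r].Pairwise (Precedes k deg) :=
    w.2.sublist (List.replicate_sublist_iff.2 (Nat.succ_le_of_lt (not_le.1 hcount)))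
  rcases List.rel_of_pairwise_cons hpair (List.mem_singleton_self r) with hlt | ⟨-, hnot⟩
  · exact lt_irrefl _ hlt
  · exact hnot hr

theorem StdWord.ext_count {w w' : StdWord k deg} (h : ∀ r, w.1.count r = w'.1.count r) :
    w = w' :=
  Subtype.ext (List.Perm.eq_of_pairwise' (r := (· ≤ ·)) (w.2.imp Precedes.le)
    (w'.2.imp Precedes.le) (List.perm_iff_count.2 h))

theorem Exponent.toWord_bijective : Function.Bijective (toWord (k := k) (deg := deg)) :=
  ⟨toWord_injective, fun w =>
    ⟨⟨fun r => w.1.count r, fun _ hodd h2 => w.count_le_one ⟨hodd, h2⟩⟩,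
      StdWord.ext_count fun r => count_toWord _ r⟩⟩

end StdWordCount

variable {k : Type*} [Field k] {n : ℕ} {deg : Fin n → ℤ}

namespace Env

section ModuleBases

variable {P : DGPoissonStructure (Poly.grading k deg)} (hP : P.IsAdmissible)
include hP

theorem isBasis_orderedMonomial_y :
    IsBasis (Poly k deg) fun J : Exponent k deg => orderedMonomial (y P) J.1 := by
  simp only [Exponent.orderedMonomial_eq_eval_toWord]
  exact (isBasis_eval hP).comp_bijective Exponent.toWord_bijective

theorem isBasis_op_orderedMonomial_y :
    IsBasis (Poly k deg)ᵐᵒᵖ fun J : Exponent k deg => orderedMonomial (y P) J.1 := by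
  simp only [Exponent.orderedMonomial_eq_eval_toWord]
  exact (isBasis_op_eval hP).comp_bijective Exponent.toWord_bijective

end ModuleBases

end Env

section PolyBasis

variable (k deg)

/-- The DG Poisson structure on `R` with zero bracket and zero differential. Its enveloping algebra
contains a second copy of `R`, generated by the `y_i`, through which the ordered monomials of `R`
are seen to form a basis. -/
def DGPoissonStructure.zeroBracket : DGPoissonStructure (Poly.grading k deg) where
  bracket := 0
  d := 0
  isDGAlgebra := ⟨by simp, by simp, by simp⟩
  mul_comm _ _ _ ha _ hb := Poly.graded_comm ha hb
  bracket_mem := by simp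
  antisymm := by simp
  jacobi := by simp
  bracket_mul := by simp
  d_bracket := by simp

open DGPoissonStructure

theorem DGPoissonStructure.zeroBracket_bracket (a b : Poly k deg) :
    (zeroBracket k deg).bracket a b = 0 := rfl

theorem DGPoissonStructure.isAdmissible_zeroBracket : (zeroBracket k deg).IsAdmissible :=
  ⟨fun _ _ => rfl, fun _ _ => rfl⟩

/-- The augmentation `R → k`, `x_i ↦ 0`. -/
def Poly.augmentation : Poly k deg →ₐ[k] k := Poly.lift 0 (by simp)

/-- The map `R → R^e`, `x_i ↦ y_i`, for the zero bracket. -/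
def Env.ofPolyZeroBracket : Poly k deg →ₐ[k] Env (zeroBracket k deg) :=
  Poly.lift (Env.y _) fun i j => by
    rw [Env.y_mul_y i j, zeroBracket_bracket, map_zero, add_zero]

/-- The map `R^e → R`, `x_i ↦ 0`, `y_i ↦ x_i`, for the zero bracket. -/
def Env.toPolyZeroBracket : Env (zeroBracket k deg) →ₐ[k] Poly k deg :=
  RingQuot.liftAlgHom k ⟨FreeExt.lift 0 (Poly.x k deg) (by simp), by
    rintro _ _ (⟨i, j⟩ | ⟨i, j⟩)
    · simp [zeroBracket_bracket, Poly.x_comm i j]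
    · simp [zeroBracket_bracket]⟩

theorem Env.ofPolyZeroBracket_x (i : Fin n) :
    Env.ofPolyZeroBracket k deg (Poly.x k deg i) = Env.y (zeroBracket k deg) i :=
  Poly.lift_x _ _ i

theorem Env.toPolyZeroBracket_y (i : Fin n) :
    Env.toPolyZeroBracket k deg (Env.y (zeroBracket k deg) i) = Poly.x k deg i :=
  (RingQuot.liftAlgHom_mkAlgHom_apply k _ _ _).trans (FreeExt.lift_y _ _ _ i)

theorem Env.toPolyZeroBracket_x (i : Fin n) :
    Env.toPolyZeroBracket k deg (Env.x (zeroBracket k deg) i) = 0 := by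
  rw [← Env.mk_x]
  exact (RingQuot.liftAlgHom_mkAlgHom_apply k _ _ _).trans (FreeExt.lift_x _ _ _ i)

theorem Env.toPolyZeroBracket_m (f : Poly k deg) :
    Env.toPolyZeroBracket k deg (Env.m (zeroBracket k deg) f) =
      algebraMap k (Poly k deg) (Poly.augmentation k deg f) := by
  have hcomp : (Env.toPolyZeroBracket k deg).comp (Env.m (zeroBracket k deg)) =
      (Algebra.ofId k (Poly k deg)).comp (Poly.augmentation k deg) := by
    refine Poly.hom_ext fun i => ?_
    rw [AlgHom.comp_apply, AlgHom.comp_apply, Poly.augmentation, Poly.lift_x, Pi.zero_apply,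
      map_zero]
    exact Env.toPolyZeroBracket_x k deg i
  exact DFunLike.congr_fun hcomp f

theorem Env.toPolyZeroBracket_ofPolyZeroBracket (f : Poly k deg) :
    Env.toPolyZeroBracket k deg (Env.ofPolyZeroBracket k deg f) = f := by
  have hcomp : (Env.toPolyZeroBracket k deg).comp (Env.ofPolyZeroBracket k deg) =
      AlgHom.id k (Poly k deg) := Poly.hom_ext fun i => by
    rw [AlgHom.comp_apply, Env.ofPolyZeroBracket_x, Env.toPolyZeroBracket_y, AlgHom.id_apply]
  exact DFunLike.congr_fun hcomp f

theorem Poly.linearIndependent_orderedMonomial :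
    LinearIndependent k fun I : Exponent k deg => orderedMonomial (Poly.x k deg) I.1 := by
  refine LinearIndependent.of_comp (Env.ofPolyZeroBracket k deg).toLinearMap ?_
  have hcomp : (Env.ofPolyZeroBracket k deg).toLinearMap ∘
      (fun I : Exponent k deg => orderedMonomial (Poly.x k deg) I.1) =
      fun J => orderedMonomial (Env.y (zeroBracket k deg)) J.1 := funext fun J => by
    simp only [Function.comp_apply, AlgHom.toLinearMap_apply, map_orderedMonomial,
      Env.ofPolyZeroBracket_x]
  have : Nontrivial (Poly k deg) := (Poly.augmentation k deg).toRingHom.domain_nontrivial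
  rw [hcomp]
  exact (Env.isBasis_orderedMonomial_y (isAdmissible_zeroBracket k deg)).1.restrict_scalars' k

theorem Env.toPolyZeroBracket_mem_span (a : Env (zeroBracket k deg)) :
    Env.toPolyZeroBracket k deg a ∈ Submodule.span k
      (Set.range fun I : Exponent k deg => orderedMonomial (Poly.x k deg) I.1) := by
  have ha : a ∈ Submodule.span (Poly k deg) (Set.range fun J : Exponent k deg =>
      orderedMonomial (Env.y (zeroBracket k deg)) J.1) := by
    rw [(Env.isBasis_orderedMonomial_y (isAdmissible_zeroBracket k deg)).2]
    exact Submodule.mem_top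
  induction ha using Submodule.span_induction with
  | mem a h =>
    obtain ⟨J, rfl⟩ := h
    simp only [map_orderedMonomial, Env.toPolyZeroBracket_y]
    exact Submodule.subset_span ⟨J, rfl⟩
  | zero => rw [map_zero]; exact Submodule.zero_mem _
  | add a b _ _ ha hb => rw [map_add]; exact Submodule.add_mem _ ha hb
  | smul f a _ ha =>
    rw [Env.smul_def, map_mul, Env.toPolyZeroBracket_m, ← Algebra.smul_def]
    exact Submodule.smul_mem _ _ ha

theorem Poly.isBasis_orderedMonomial :
    IsBasis k fun I : Exponent k deg => orderedMonomial (Poly.x k deg) I.1 :=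
  ⟨Poly.linearIndependent_orderedMonomial k deg, eq_top_iff.2 fun f _ =>
    Env.toPolyZeroBracket_ofPolyZeroBracket k deg f ▸
      Env.toPolyZeroBracket_mem_span k deg (Env.ofPolyZeroBracket k deg f)⟩

end PolyBasis

namespace Env

variable {P : DGPoissonStructure (Poly.grading k deg)}

theorem m_orderedMonomial (I : Fin n → ℕ) :
    m P (orderedMonomial (Poly.x k deg) I) = orderedMonomial (x P) I :=
  map_orderedMonomial (m P) _ I

theorem isBasis_orderedMonomial_x_mul_y (hP : P.IsAdmissible) :
    IsBasis k fun IJ : Exponent k deg × Exponent k deg =>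
      orderedMonomial (x P) IJ.1.1 * orderedMonomial (y P) IJ.2.1 := by
  simpa only [smul_def, m_orderedMonomial] using
    (Poly.isBasis_orderedMonomial k deg).smul (isBasis_orderedMonomial_y hP)

theorem isBasis_orderedMonomial_y_mul_x (hP : P.IsAdmissible) :
    IsBasis k fun JI : Exponent k deg × Exponent k deg =>
      orderedMonomial (y P) JI.1.1 * orderedMonomial (x P) JI.2.1 := by
  have hop := (Poly.isBasis_orderedMonomial k deg).map_linearEquiv (MulOpposite.opLinearEquiv k)
  simpa only [MulOpposite.coe_opLinearEquiv, op_smul_def, m_orderedMonomial, Prod.fst_swap,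
    Prod.snd_swap] using
    (hop.smul (isBasis_op_orderedMonomial_y hP)).comp_bijective Prod.swap_bijective

end Env

end DGPoisson

theorem mainTheorem3 {k : Type*} [Field k] {n : ℕ} (deg : Fin n → ℤ)
    (P : DGPoisson.DGPoissonStructure (DGPoisson.Poly.grading k deg))
    (h2 : (2 : k) = 0 → ∀ i,
      P.bracket (DGPoisson.Poly.x k deg i) (DGPoisson.Poly.x k deg i) = 0)
    (h3 : (3 : k) = 0 → ∀ i, Odd (deg i) →
      P.bracket (DGPoisson.Poly.x k deg i)
        (P.bracket (DGPoisson.Poly.x k deg i) (DGPoisson.Poly.x k deg i)) = 0) :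
    ∃ δ : DGPoisson.Env P →ₗ[k] DGPoisson.Env P,
      -- `R^e` is a DG algebra, with the differential extending that of `R`
      DGPoisson.IsDGAlgebra (DGPoisson.Env.grading P) δ ∧
      (∀ f, δ (DGPoisson.Env.m P f) = DGPoisson.Env.m P (P.d f)) ∧
      (∀ f, δ (DGPoisson.Env.h P f) = DGPoisson.Env.h P (P.d f)) ∧
      -- hence a left and a right DG module over `R`
      DGPoisson.IsLeftDGModule (DGPoisson.Poly.grading k deg) P.d (DGPoisson.Env.grading P) δ ∧
      DGPoisson.IsRightDGModule (DGPoisson.Poly.grading k deg) P.d (DGPoisson.Env.grading P) δ ∧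
      -- the monomials in the `y_r` are homogeneous
      (∀ J : DGPoisson.Exponent k deg, DGPoisson.orderedMonomial (DGPoisson.Env.y P) J.1 ∈
        DGPoisson.Env.grading P (∑ r, (J.1 r : ℤ) * deg r)) ∧
      -- and form a basis of `R^e` as a left and as a right `R`-module
      DGPoisson.IsBasis (DGPoisson.Poly k deg)
        (fun J : DGPoisson.Exponent k deg =>
          DGPoisson.orderedMonomial (DGPoisson.Env.y P) J.1) ∧
      DGPoisson.IsBasis (DGPoisson.Poly k deg)ᵐᵒᵖ
        (fun J : DGPoisson.Exponent k deg =>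
          DGPoisson.orderedMonomial (DGPoisson.Env.y P) J.1) ∧
      -- the monomials `x^I y^J`, and the reversed monomials `y^J x^I`, are `k`-bases of `R^e`
      DGPoisson.IsBasis k
        (fun IJ : DGPoisson.Exponent k deg × DGPoisson.Exponent k deg =>
          DGPoisson.orderedMonomial (DGPoisson.Env.x P) IJ.1.1 *
            DGPoisson.orderedMonomial (DGPoisson.Env.y P) IJ.2.1) ∧
      DGPoisson.IsBasis k
        (fun JI : DGPoisson.Exponent k deg × DGPoisson.Exponent k deg =>
          DGPoisson.orderedMonomial (DGPoisson.Env.y P) JI.1.1 *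
            DGPoisson.orderedMonomial (DGPoisson.Env.x P) JI.2.1) := by
  have hP := P.isAdmissible h2 h3
  exact ⟨DGPoisson.Env.diff P, DGPoisson.Env.isDGAlgebra P, DGPoisson.Env.diff_m P,
    DGPoisson.Env.diff_h P, DGPoisson.Env.isLeftDGModule P, DGPoisson.Env.isRightDGModule P,
    fun J => DGPoisson.orderedMonomial_mem DGPoisson.Env.y_mem J.1,
    DGPoisson.Env.isBasis_orderedMonomial_y hP, DGPoisson.Env.isBasis_op_orderedMonomial_y hP,
    DGPoisson.Env.isBasis_orderedMonomial_x_mul_y hP,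
    DGPoisson.Env.isBasis_orderedMonomial_y_mul_x hP⟩
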